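/- \textbf{Setting.} A B-MAC amplify-and-forward relay network has $L$ links and $Q\ge 1$ relay clusters. The source and destination of link $l$ have $L_{T_l}\ge1$ and $L_{R_l}\ge 1$ antennas. The channels are $\mathbf H_0^l$ (source of link $l$ to cluster $1$), $\mathbf H_q$ (cluster $q$ to cluster $q+1$, $1\le q\le Q-1$) and $\mathbf H_Q^l$ (cluster $Q$ to the destination of link $l$). The noise covariances $\mathbf W_q$ (cluster $q$) and $\mathbf W_{Q+1}^l$ (destination of link $l$), and the weight matrices $\hat{\mathbf W}_0^l$ and $\hat{\mathbf W}_q$ ($1\le q\le Q$), are positive definite. The coupling matrix $\mathbf\Phi=(\phi_{l,k})\in\{0,1\}^{L\times L}$ has zero diagonal. The precoder $\mathbf F_q$ of cluster $q$ is block diagonal, with one square block per relay. For $q\le q'$ put $\mathbf B_{q,q'}=\mathbf F_{q'}\mathbf H_{q'-1}\mathbf F_{q'-1}\cdots\mathbf H_q\mathbf F_q$. For input covariances $\mathbf\Sigma_l\succeq0$ put $$\check{\mathbf H}_{l,k}=\mathbf H_Q^l\mathbf B_{1,Q}\mathbf H_0^k,\qquad \mathbf W_l'=\sum_{q=1}^Q\mathbf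 H_Q^l\mathbf B_{q,Q}\mathbf W_q\mathbf B_{q,Q}^\dagger\mathbf H_Q^{l\dagger}+\mathbf W_{Q+1}^l,$$ $$\mathbf\Omega_l=\mathbf W_l'+\sum_k\phi_{l,k}\check{\mathbf H}_{l,k}\mathbf\Sigma_k\check{\mathbf H}_{l,k}^\dagger,\qquad \mathcal I_l(\mathbf\Sigma,\mathbf F)=\log\left|\mathbf I+\check{\mathbf H}_{l,l}\mathbf\Sigma_l\check{\mathbf H}_{l,l}^\dagger\mathbf\Omega_l^{-1}\right|,$$ $$\mathbf\Sigma_q^R=\sum_l\mathbf B_{1,q}\mathbf H_0^l\mathbf\Sigma_l\mathbf H_0^{l\dagger}\mathbf B_{1,q}^\dagger+\sum_{q'=1}^q\mathbf B_{q',q}\mathbf W_{q'}\mathbf B_{q',q}^\dagger.$$ The per-hop costs are $P_0^{\rm tx}=\sum_l\mathrm{Tr}(\mathbf\Sigma_l\hat{\mathbf W}_0^l)$ and $P_q^{\rm tx}=\mathrm{Tr}(\mathbf\Sigma_q^R\hat{\mathbf W}_q)$ for $1\le q\le Q$. The per-hop linear constraint with bounds $P_0,\dots,P_Q\in\mathbb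 R$ is $P_q^{\rm tx}\le P_q$ for $0\le q\le Q$. \textbf{Dual network.} All directions are reversed and all channels are replaced by their conjugate transposes. The noise covariances are $\hat{\mathbf W}_q$ at cluster $q$ and $\hat{\mathbf W}_0^l$ at the destination of dual link $l$ (the original source of link $l$). The coupling matrix is $\mathbf\Phi^T$. For dual precoders $\hat{\mathbf F}$ put $\hat{\mathbf B}_{q,q'}=\hat{\mathbf F}_{q'}^\dagger\mathbf H_{q'-1}\cdots\mathbf H_q\hat{\mathbf F}_q^\dagger$ and $\hat{\mathbf H}_{l,k}=\mathbf H_0^{l\dagger}\hat{\mathbf B}_{1,Q}^\dagger\mathbf H_Q^{k\dagger}$. For dual input covariances $\hat{\mathbf\Sigma}_l\succeq 0$ put $$\hat{\mathbf\Omega}_l=\hat{\mathbf W}_0^l+\sum_{q=1}^Q\mathbf H_0^{l\dagger}\hat{\mathbf B}_{1,q}^\dagger\hat{\mathbf W}_q\hat{\mathbf B}_{1,q}\mathbf H_0^l+\sum_k\phi_{k,l}\hat{\mathbf H}_{l,k}\hat{\mathbf\Sigma}_k\hat{\mathbf H}_{l,k}^\dagger,\qquad \hat{\mathcal I}_l(\hat{\mathbf\Sigma},\hat{\mathbf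 F})=\log\left|\mathbf I+\hat{\mathbf H}_{l,l}\hat{\mathbf\Sigma}_l\hat{\mathbf H}_{l,l}^\dagger\hat{\mathbf\Omega}_l^{-1}\right|,$$ $$\hat{\mathbf\Sigma}_q^R=\sum_l\hat{\mathbf B}_{q,Q}^\dagger\mathbf H_Q^{l\dagger}\hat{\mathbf\Sigma}_l\mathbf H_Q^l\hat{\mathbf B}_{q,Q}+\sum_{q'=q}^Q\hat{\mathbf B}_{q,q'}^\dagger\hat{\mathbf W}_{q'}\hat{\mathbf B}_{q,q'}.$$ The dual per-hop linear constraint is $\sum_l\mathrm{Tr}(\hat{\mathbf\Sigma}_l\mathbf W_{Q+1}^l)\le P_Q$ and $\mathrm{Tr}(\hat{\mathbf\Sigma}_q^R\mathbf W_q)\le P_{q-1}$ for $1\le q\le Q$. The achievable region of either network is the set of vectors $\mathbf x\in\mathbb R_{\ge0}^L$ that are componentwise at most the rate vector of some positive semidefinite input covariances and block diagonal precoders that satisfy the respective constraint. \textbf{Type II dual transformation of $\mathbf\Sigma,\mathbf F$.} (1) Decompose $\mathbf\Sigma_l=\sum_{m=1}^{M_l}p_{l,m}\mathbf t_{l,m}\mathbf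 t_{l,m}^\dagger$ with $p_{l,m}>0$ and $\|\mathbf t_{l,m}\|=1$. (2) Let $\mathbf r_{l,m}$ be the unit vector proportional to $\bigl(\sum_{i>m}p_{l,i}\check{\mathbf H}_{l,l}\mathbf t_{l,i}\mathbf t_{l,i}^\dagger\check{\mathbf H}_{l,l}^\dagger+\mathbf\Omega_l\bigr)^{-1}\check{\mathbf H}_{l,l}\mathbf t_{l,m}$; if $\check{\mathbf H}_{l,l}\mathbf t_{l,m}=0$, let it be any unit vector. (3) Let $\mathbf\Psi$ be indexed by streams, with entry in row $(l,m)$ and column $(k,n)$ equal to $|\mathbf r_{l,m}^\dagger\check{\mathbf H}_{l,l}\mathbf t_{l,n}|^2$ if $k=l$ and $m<n$, to $0$ if $k=l$ and $m\ge n$, and to $\phi_{l,k}|\mathbf r_{l,m}^\dagger\check{\mathbf H}_{l,k}\mathbf t_{k,n}|^2$ if $k\ne l$. The SINR is $\gamma_{l,m}=p_{l,m}|\mathbf r_{l,m}^\dagger\check{\mathbf H}_{l,l}\mathbf t_{l,m}|^2/\bigl(\mathbf r_{l,m}^\dagger\mathbf W_l'\mathbf r_{l,m}+(\mathbf\Psi\mathbf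 p)_{l,m}\bigr)$. Let $\mathbf D$ be diagonal with entries $\gamma_{l,m}/|\mathbf r_{l,m}^\dagger\check{\mathbf H}_{l,l}\mathbf t_{l,m}|^2$ (read with the common factor cancelled where it vanishes). (4) For $0\le q,q'\le Q$ let $a_{q,q'}=\mathbf n_q^T(\mathbf D^{-1}-\mathbf\Psi^T)^{-1}\hat{\mathbf n}_{q'}$. Here, for $1\le q\le Q$, $n^{q-1}_{l,m}=\mathbf r_{l,m}^\dagger\mathbf H_Q^l\mathbf B_{q,Q}\mathbf W_q\mathbf B_{q,Q}^\dagger\mathbf H_Q^{l\dagger}\mathbf r_{l,m}$ and $\hat n^q_{l,m}=\mathbf t_{l,m}^\dagger\mathbf H_0^{l\dagger}\mathbf B_{1,q}^\dagger\hat{\mathbf W}_q\mathbf B_{1,q}\mathbf H_0^l\mathbf t_{l,m}$, while $n^Q_{l,m}=\mathbf r_{l,m}^\dagger\mathbf W_{Q+1}^l\mathbf r_{l,m}$ and $\hat n^0_{l,m}=\mathbf t_{l,m}^\dagger\hat{\mathbf W}_0^l\mathbf t_{l,m}$. Let $b_{q,q'}=\mathrm{Tr}(\mathbf B_{q,q'}\mathbf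 W_q\mathbf B_{q,q'}^\dagger\hat{\mathbf W}_{q'})$. Let $\mathbf A\in\mathbb R^{(Q+1)\times(Q+1)}$ have $(q,q')$ entry $(a_{q-1,q'-1}+b_{q,q'-1})/P_{q-1}^{\rm tx}$ if $q'>q$ and $a_{q-1,q'-1}/P_{q-1}^{\rm tx}$ otherwise, and let $\tilde{\mathbf d}=[\tilde d_1,\dots,\tilde d_Q,1]^T$ be an eigenvector of $\mathbf A$ for its largest eigenvalue, scaled to have last component $\tilde d_{Q+1}=1$. (5) Put $\hat{\mathbf\Sigma}_l=\sum_m q_{l,m}\mathbf r_{l,m}\mathbf r_{l,m}^\dagger$, where $\mathbf q=(\mathbf D^{-1}-\mathbf\Psi^T)^{-1}\hat{\mathbf n}$, $\hat n_{l,m}=\mathbf t_{l,m}^\dagger\hat{\mathbf W}_l'(\tilde{\mathbf d})\mathbf t_{l,m}$ and $\hat{\mathbf W}_l'(\tilde{\mathbf d})=\sum_{q=1}^Q\tilde d_{q+1}\mathbf H_0^{l\dagger}\mathbf B_{1,q}^\dagger\hat{\mathbf W}_q\mathbf B_{1,q}\mathbf H_0^l+\tilde d_1\hat{\mathbf W}_0^l$.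 Put $\hat{\mathbf F}_q=\sqrt{\tilde d_{q+1}/\tilde d_q}\,\mathbf F_q^\dagger$ for $1\le q\le Q$. \textbf{Theorem (Type II duality).} Let $\mathbf\Sigma_l\succeq0$ be not all zero, let $\mathbf F_q\neq0$ for $1\le q\le Q$, and suppose that $\mathbf\Sigma,\mathbf F$ satisfy the per-hop linear constraint $P_q^{\rm tx}\le P_q$, $0\le q\le Q$. Then the Type II dual transformation of $\mathbf\Sigma,\mathbf F$ exists. For every choice of streams and receive vectors in (1)--(2), the vector $\tilde{\mathbf d}$ is unique and strictly positive. Every resulting $\hat{\mathbf\Sigma},\hat{\mathbf F}$ has $\hat{\mathbf\Sigma}_l\succeq0$ and achieves $\hat{\mathcal I}_l(\hat{\mathbf\Sigma},\hat{\mathbf F})\ge\mathcal I_l(\mathbf\Sigma,\mathbf F)$ for all $l$. It satisfies $$\sum_{l}\mathrm{Tr}(\hat{\mathbf\Sigma}_l\mathbf W_{Q+1}^l)=P_Q^{\rm tx},\qquad \mathrm{Tr}(\hat{\mathbf\Sigma}_q^R\mathbf W_q)=P_{q-1}^{\rm tx},\quad 1\le q\le Q,$$ and hence the dual per-hop linear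 constraint. Moreover, for all $P_0,\dots,P_Q$, the achievable region of the network under the per-hop linear constraint and that of the dual network under the dual per-hop linear constraint are the same. -/

import Mathlib

open Matrix
open scoped ComplexOrder

noncomputable section

/-! Single-hop MIMO interference networks with a coupling matrix `φ`: `L` links, link `l` having
`tx l` transmit and `rx l` receive antennas, channel `G l k` from the transmitter of link `k` to
the receiver of link `l`, noise covariance `V l`. -/

/-- `M * X * Mᴴ`. -/
def sandwich {m n : Type*} [Fintype n] (M : Matrix m n ℂ) (X : Matrix n n ℂ) : Matrix m m ℂ :=
  M * X * Mᴴ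

/-- The real number `v† M v` (for Hermitian `M`). -/
def quadForm {n : ℕ} (M : Matrix (Fin n) (Fin n) ℂ) (v : Fin n → ℂ) : ℝ :=
  (star v ⬝ᵥ (M *ᵥ v)).re

/-- The rank-one matrix `v v†`. -/
def rankOne {n : ℕ} (v : Fin n → ℂ) : Matrix (Fin n) (Fin n) ℂ :=
  vecMulVec v (star v)

namespace IFN

variable {L : ℕ} {tx rx : Fin L → ℕ}

/-- Interference-plus-noise covariance at the receiver of link `l`. -/
def omega (φ : Matrix (Fin L) (Fin L) ℝ)
    (G : (l k : Fin L) → Matrix (Fin (rx l)) (Fin (tx k)) ℂ)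
    (V : (l : Fin L) → Matrix (Fin (rx l)) (Fin (rx l)) ℂ)
    (S : (l : Fin L) → Matrix (Fin (tx l)) (Fin (tx l)) ℂ) (l : Fin L) :
    Matrix (Fin (rx l)) (Fin (rx l)) ℂ :=
  V l + ∑ k, φ l k • sandwich (G l k) (S k)

/-- The rate `log |I + G_{l,l} S_l G_{l,l}† Ω_l⁻¹|` of link `l`. -/
def rate (φ : Matrix (Fin L) (Fin L) ℝ)
    (G : (l k : Fin L) → Matrix (Fin (rx l)) (Fin (tx k)) ℂ)
    (V : (l : Fin L) → Matrix (Fin (rx l)) (Fin (rx l)) ℂ)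
    (S : (l : Fin L) → Matrix (Fin (tx l)) (Fin (tx l)) ℂ) (l : Fin L) : ℝ :=
  Real.log (1 + sandwich (G l l) (S l) * (omega φ G V S l)⁻¹).det.re

/-- Data of a stream decomposition: link `l` carries `M l` streams; stream `s = ⟨l, m⟩` has power
`p s`, transmit vector `t s` and receive vector `r s`. -/
structure Streams (L : ℕ) (tx rx : Fin L → ℕ) where
  M : Fin L → ℕ
  p : (Σ l : Fin L, Fin (M l)) → ℝ
  t : (s : Σ l : Fin L, Fin (M l)) → Fin (tx s.1) → ℂ
  r : (s : Σ l : Fin L, Fin (M l)) → Fin (rx s.1) → ℂ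

/-- `D` is a decomposition of the covariances `S` into streams of positive power with unit transmit
vectors, together with unit MMSE-SIC receive vectors. The MMSE formula determines `r` up to a
phase as long as `G_{l,l} t ≠ 0`; a stream that does not reach its own receiver
(`G_{l,l} t = 0`) may use any unit receive vector. -/
structure IsDecomposition (φ : Matrix (Fin L) (Fin L) ℝ)
    (G : (l k : Fin L) → Matrix (Fin (rx l)) (Fin (tx k)) ℂ)
    (V : (l : Fin L) → Matrix (Fin (rx l)) (Fin (rx l)) ℂ)
    (S : (l : Fin L) → Matrix (Fin (tx l)) (Fin (tx l)) ℂ)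
    (D : Streams L tx rx) : Prop where
  p_pos : ∀ s, 0 < D.p s
  t_unit : ∀ s, star (D.t s) ⬝ᵥ D.t s = 1
  sum_eq : ∀ l, S l = ∑ m : Fin (D.M l), D.p ⟨l, m⟩ • rankOne (D.t ⟨l, m⟩)
  r_unit : ∀ s, star (D.r s) ⬝ᵥ D.r s = 1
  r_mmse : ∀ (l : Fin L) (m : Fin (D.M l)), G l l *ᵥ D.t ⟨l, m⟩ ≠ 0 →
    ∃ α : ℂ, D.r ⟨l, m⟩ = α •
      ((∑ i with m < i, D.p ⟨l, i⟩ • sandwich (G l l) (rankOne (D.t ⟨l, i⟩)) + omega φ G V S l)⁻¹ *ᵥ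
        (G l l *ᵥ D.t ⟨l, m⟩))

namespace Streams

/-- `|r_s† G t_{s'}|²`, where `G` is the channel from the transmitter of the link of `s'` to the
receiver of the link of `s`. -/
def gain (D : Streams L tx rx)
    (G : (l k : Fin L) → Matrix (Fin (rx l)) (Fin (tx k)) ℂ)
    (s s' : Σ l : Fin L, Fin (D.M l)) : ℝ :=
  ‖star (D.r s) ⬝ᵥ (G s.1 s'.1 *ᵥ D.t s')‖ ^ 2

/-- The cross-talk matrix `Ψ`: entry `(s, s')` is the gain from stream `s'` to stream `s`, with
successive cancellation inside a link and the coupling matrix between links. -/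
def crosstalk (D : Streams L tx rx) (φ : Matrix (Fin L) (Fin L) ℝ)
    (G : (l k : Fin L) → Matrix (Fin (rx l)) (Fin (tx k)) ℂ) :
    Matrix (Σ l : Fin L, Fin (D.M l)) (Σ l : Fin L, Fin (D.M l)) ℝ :=
  fun s s' =>
    if s.1 = s'.1 then (if s.2.val < s'.2.val then D.gain G s s' else 0)
    else φ s.1 s'.1 * D.gain G s s'

/-- Interference-plus-noise power of stream `s` after its receive vector. -/
def noisePower (D : Streams L tx rx) (φ : Matrix (Fin L) (Fin L) ℝ)
    (G : (l k : Fin L) → Matrix (Fin (rx l)) (Fin (tx k)) ℂ)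
    (V : (l : Fin L) → Matrix (Fin (rx l)) (Fin (rx l)) ℂ)
    (s : Σ l : Fin L, Fin (D.M l)) : ℝ :=
  quadForm (V s.1) (D.r s) + (D.crosstalk φ G *ᵥ D.p) s

/-- The SINR `γ_s` of stream `s`. -/
def sinr (D : Streams L tx rx) (φ : Matrix (Fin L) (Fin L) ℝ)
    (G : (l k : Fin L) → Matrix (Fin (rx l)) (Fin (tx k)) ℂ)
    (V : (l : Fin L) → Matrix (Fin (rx l)) (Fin (rx l)) ℂ)
    (s : Σ l : Fin L, Fin (D.M l)) : ℝ :=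
  D.p s * D.gain G s s / D.noisePower φ G V s

/-- The diagonal matrix `D` with entries `γ_s / |r_s† G t_s|²`. Where the gain vanishes this
quotient is read with the common factor cancelled. -/
def sinrMatrix (D : Streams L tx rx) (φ : Matrix (Fin L) (Fin L) ℝ)
    (G : (l k : Fin L) → Matrix (Fin (rx l)) (Fin (tx k)) ℂ)
    (V : (l : Fin L) → Matrix (Fin (rx l)) (Fin (rx l)) ℂ) :
    Matrix (Σ l : Fin L, Fin (D.M l)) (Σ l : Fin L, Fin (D.M l)) ℝ :=
  Matrix.diagonal fun s =>
    if D.gain G s s = 0 then D.p s / D.noisePower φ G V s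
    else D.sinr φ G V s / D.gain G s s

/-- The matrix `(D⁻¹ - Ψᵀ)⁻¹`. -/
def powerMatrix (D : Streams L tx rx) (φ : Matrix (Fin L) (Fin L) ℝ)
    (G : (l k : Fin L) → Matrix (Fin (rx l)) (Fin (tx k)) ℂ)
    (V : (l : Fin L) → Matrix (Fin (rx l)) (Fin (rx l)) ℂ) :
    Matrix (Σ l : Fin L, Fin (D.M l)) (Σ l : Fin L, Fin (D.M l)) ℝ :=
  ((D.sinrMatrix φ G V)⁻¹ - (D.crosstalk φ G)ᵀ)⁻¹

/-- The covariance transformation with parameters `G`, `V`, `Vhat`: the reverse-link covariances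
`∑ₘ q_{l,m} r_{l,m} r_{l,m}†` with `q = (D⁻¹ - Ψᵀ)⁻¹ n̂` and `n̂_{l,m} = t_{l,m}† Vhat_l t_{l,m}`. -/
def covTransform (D : Streams L tx rx) (φ : Matrix (Fin L) (Fin L) ℝ)
    (G : (l k : Fin L) → Matrix (Fin (rx l)) (Fin (tx k)) ℂ)
    (V : (l : Fin L) → Matrix (Fin (rx l)) (Fin (rx l)) ℂ)
    (Vhat : (l : Fin L) → Matrix (Fin (tx l)) (Fin (tx l)) ℂ) (l : Fin L) :
    Matrix (Fin (rx l)) (Fin (rx l)) ℂ :=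
  ∑ m : Fin (D.M l),
    (D.powerMatrix φ G V *ᵥ fun s => quadForm (Vhat s.1) (D.t s)) ⟨l, m⟩ • rankOne (D.r ⟨l, m⟩)

end Streams

end IFN

/-- A multi-hop amplify-and-forward relay network with `L` links and `Q ≥ 1` relay clusters,
together with the weight matrices of its linear constraints. Clusters are numbered `1, …, Q` as
natural numbers; data attached to other cluster numbers are never used. Cluster `q` has
`numRelays q` relays, the `j`-th of which has `relayAnt q j` antennas, so that the antennas of the
cluster are indexed by `Σ j, Fin (relayAnt q j)`. -/
structure RelayNetwork where
  L : ℕ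
  Q : ℕ
  Q_pos : 1 ≤ Q
  tx : Fin L → ℕ
  rx : Fin L → ℕ
  tx_pos : ∀ l, 0 < tx l
  rx_pos : ∀ l, 0 < rx l
  numRelays : ℕ → ℕ
  relayAnt : (q : ℕ) → Fin (numRelays q) → ℕ
  /-- channel from the source of link `l` to cluster `1` -/
  H0 : (l : Fin L) → Matrix (Σ j, Fin (relayAnt 1 j)) (Fin (tx l)) ℂ
  /-- channel from cluster `q` to cluster `q + 1`, used for `1 ≤ q ≤ Q - 1` -/
  H : (q : ℕ) → Matrix (Σ j, Fin (relayAnt (q + 1) j)) (Σ j, Fin (relayAnt q j)) ℂ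
  /-- channel from cluster `Q` to the destination of link `l` -/
  HQ : (l : Fin L) → Matrix (Fin (rx l)) (Σ j, Fin (relayAnt Q j)) ℂ
  /-- coupling matrix -/
  φ : Matrix (Fin L) (Fin L) ℝ
  φ_binary : ∀ l k, φ l k = 0 ∨ φ l k = 1
  φ_diag : ∀ l, φ l l = 0
  /-- noise covariance at cluster `q` -/
  W : (q : ℕ) → Matrix (Σ j, Fin (relayAnt q j)) (Σ j, Fin (relayAnt q j)) ℂ
  W_posDef : ∀ q, 1 ≤ q → q ≤ Q → (W q).PosDef
  /-- noise covariance `W_{Q+1}^l` at the destination of link `l` -/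
  Wdest : (l : Fin L) → Matrix (Fin (rx l)) (Fin (rx l)) ℂ
  Wdest_posDef : ∀ l, (Wdest l).PosDef
  /-- weight matrix for cluster `q` -/
  What : (q : ℕ) → Matrix (Σ j, Fin (relayAnt q j)) (Σ j, Fin (relayAnt q j)) ℂ
  What_posDef : ∀ q, 1 ≤ q → q ≤ Q → (What q).PosDef
  /-- weight matrix `Ŵ_0^l` for the source of link `l` -/
  Whatsrc : (l : Fin L) → Matrix (Fin (tx l)) (Fin (tx l)) ℂ
  Whatsrc_posDef : ∀ l, (Whatsrc l).PosDef

namespace RelayNetwork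

/-- Antennas of relay cluster `q`. -/
abbrev Ant (N : RelayNetwork) (q : ℕ) : Type := Σ j : Fin (N.numRelays q), Fin (N.relayAnt q j)

/-- Input covariances of the network (one per source). -/
abbrev Cov (N : RelayNetwork) : Type := (l : Fin N.L) → Matrix (Fin (N.tx l)) (Fin (N.tx l)) ℂ

/-- Input covariances of the dual network (one per destination of the original network). -/
abbrev DualCov (N : RelayNetwork) : Type :=
  (l : Fin N.L) → Matrix (Fin (N.rx l)) (Fin (N.rx l)) ℂ

/-- Relay precoders: one square matrix for each relay of each cluster. -/
abbrev Precoders (N : RelayNetwork) : Type :=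
  (q : ℕ) → (j : Fin (N.numRelays q)) → Matrix (Fin (N.relayAnt q j)) (Fin (N.relayAnt q j)) ℂ

/-- The composite (block diagonal) precoding matrix of cluster `q`. -/
def composite (N : RelayNetwork) (F : N.Precoders) (q : ℕ) : Matrix (N.Ant q) (N.Ant q) ℂ :=
  Matrix.blockDiagonal' (F q)

/-- `B_{q,q'} = F_{q'} H_{q'-1} F_{q'-1} ⋯ H_q F_q` for `q ≤ q'` (and `0` otherwise). -/
def B (N : RelayNetwork) (F : N.Precoders) (q q' : ℕ) : Matrix (N.Ant q') (N.Ant q) ℂ :=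
  if h : q ≤ q' then
    Nat.leRec (motive := fun k _ => Matrix (N.Ant k) (N.Ant q) ℂ) (N.composite F q)
      (fun k _ X => N.composite F (k + 1) * N.H k * X) h
  else 0

/-- Equivalent channel from the source of link `k` to the destination of link `l`. -/
def channel (N : RelayNetwork) (F : N.Precoders) (l k : Fin N.L) :
    Matrix (Fin (N.rx l)) (Fin (N.tx k)) ℂ :=
  N.HQ l * N.B F 1 N.Q * N.H0 k

/-- Equivalent noise covariance `W'_l` at the destination of link `l`. -/
def noise (N : RelayNetwork) (F : N.Precoders) (l : Fin N.L) :
    Matrix (Fin (N.rx l)) (Fin (N.rx l)) ℂ :=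
  ∑ q ∈ Finset.Icc 1 N.Q, sandwich (N.HQ l * N.B F q N.Q) (N.W q) + N.Wdest l

/-- Covariance of the transmit signal of cluster `q`. -/
def relayCov (N : RelayNetwork) (S : N.Cov) (F : N.Precoders) (q : ℕ) :
    Matrix (N.Ant q) (N.Ant q) ℂ :=
  ∑ l, sandwich (N.B F 1 q * N.H0 l) (S l) + ∑ q' ∈ Finset.Icc 1 q, sandwich (N.B F q' q) (N.W q')

/-- Achievable rate of link `l`. -/
def rate (N : RelayNetwork) (S : N.Cov) (F : N.Precoders) (l : Fin N.L) : ℝ :=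
  IFN.rate N.φ (N.channel F) (N.noise F) S l

/-- The per-hop costs `P_q^tx`, `0 ≤ q ≤ Q`: the source cost for `q = 0` and the cost of cluster
`q` for `q ≥ 1`. -/
def txCost (N : RelayNetwork) (S : N.Cov) (F : N.Precoders) (q : ℕ) : ℝ :=
  if q = 0 then (∑ l, (S l * N.Whatsrc l).trace).re
  else (N.relayCov S F q * N.What q).trace.re

/-- The per-hop linear constraint with bounds `P 0, …, P Q`. -/
def PerHop (N : RelayNetwork) (P : ℕ → ℝ) (S : N.Cov) (F : N.Precoders) : Prop :=
  ∀ q, q ≤ N.Q → N.txCost S F q ≤ P q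

/-- The achievable rate region under the per-hop linear constraint. -/
def region (N : RelayNetwork) (P : ℕ → ℝ) : Set (Fin N.L → ℝ) :=
  {x | (∀ l, 0 ≤ x l) ∧ ∃ (S : N.Cov) (F : N.Precoders),
    (∀ l, (S l).PosSemidef) ∧ N.PerHop P S F ∧ ∀ l, x l ≤ N.rate S F l}

/-! The dual network: directions reversed, channels replaced by conjugate transposes, noise
covariances `What q` at cluster `q` and `Whatsrc l` at the destination of dual link `l`, coupling
matrix `φᵀ`. -/

/-- `B̂_{q,q'} = F̂_{q'}† H_{q'-1} F̂_{q'-1}† ⋯ H_q F̂_q†`. -/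
def dualB (N : RelayNetwork) (F : N.Precoders) (q q' : ℕ) : Matrix (N.Ant q') (N.Ant q) ℂ :=
  N.B (fun q j => (F q j)ᴴ) q q'

/-- Equivalent channel of the dual network from the source of dual link `k` to the destination of
dual link `l`. -/
def dualChannel (N : RelayNetwork) (F : N.Precoders) (l k : Fin N.L) :
    Matrix (Fin (N.tx l)) (Fin (N.rx k)) ℂ :=
  (N.H0 l)ᴴ * (N.dualB F 1 N.Q)ᴴ * (N.HQ k)ᴴ

/-- Equivalent noise covariance at the destination of dual link `l`. -/
def dualNoise (N : RelayNetwork) (F : N.Precoders) (l : Fin N.L) :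
    Matrix (Fin (N.tx l)) (Fin (N.tx l)) ℂ :=
  N.Whatsrc l + ∑ q ∈ Finset.Icc 1 N.Q, sandwich ((N.H0 l)ᴴ * (N.dualB F 1 q)ᴴ) (N.What q)

/-- Covariance of the transmit signal of cluster `q` in the dual network. -/
def dualRelayCov (N : RelayNetwork) (S : N.DualCov) (F : N.Precoders) (q : ℕ) :
    Matrix (N.Ant q) (N.Ant q) ℂ :=
  ∑ l, sandwich ((N.dualB F q N.Q)ᴴ * (N.HQ l)ᴴ) (S l)
    + ∑ q' ∈ Finset.Icc q N.Q, sandwich (N.dualB F q q')ᴴ (N.What q')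

/-- Achievable rate of dual link `l`. -/
def dualRate (N : RelayNetwork) (S : N.DualCov) (F : N.Precoders) (l : Fin N.L) : ℝ :=
  IFN.rate N.φᵀ (N.dualChannel F) (N.dualNoise F) S l

/-- `∑ₗ Tr (Σ̂_l W_{Q+1}^l)`. -/
def dualSourceCost (N : RelayNetwork) (S : N.DualCov) : ℝ :=
  (∑ l, (S l * N.Wdest l).trace).re

/-- `Tr (Σ̂_q^R W_q)`. -/
def dualRelayCost (N : RelayNetwork) (S : N.DualCov) (F : N.Precoders) (q : ℕ) : ℝ :=
  (N.dualRelayCov S F q * N.W q).trace.re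

/-- The per-hop linear constraint of the dual network. -/
def DualPerHop (N : RelayNetwork) (P : ℕ → ℝ) (S : N.DualCov) (F : N.Precoders) : Prop :=
  N.dualSourceCost S ≤ P N.Q ∧ ∀ q, 1 ≤ q → q ≤ N.Q → N.dualRelayCost S F q ≤ P (q - 1)

/-- The achievable rate region of the dual network under its per-hop linear constraint. -/
def dualRegion (N : RelayNetwork) (P : ℕ → ℝ) : Set (Fin N.L → ℝ) :=
  {x | (∀ l, 0 ≤ x l) ∧ ∃ (S : N.DualCov) (F : N.Precoders),
    (∀ l, (S l).PosSemidef) ∧ N.DualPerHop P S F ∧ ∀ l, x l ≤ N.dualRate S F l}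

/-! The Type II dual transformation. -/

/-- A stream decomposition of the input covariances `S` for the equivalent single-hop network that
results from the precoders `F`. -/
def IsStreamDecomposition (N : RelayNetwork) (S : N.Cov) (F : N.Precoders)
    (D : IFN.Streams N.L N.tx N.rx) : Prop :=
  IFN.IsDecomposition N.φ (N.channel F) (N.noise F) S D

/-- `b_{q,q'} = Tr (B_{q,q'} W_q B_{q,q'}† Ŵ_{q'})`. -/
def b (N : RelayNetwork) (F : N.Precoders) (q q' : ℕ) : ℝ :=
  (sandwich (N.B F q q') (N.W q) * N.What q').trace.re

/-- The vectors `n_q`, `0 ≤ q ≤ Q`: for `q < Q` the part of the noise power of each stream that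
stems from cluster `q + 1`, for `q = Q` the part that stems from the destination. -/
def fwdNoise (N : RelayNetwork) (F : N.Precoders) (D : IFN.Streams N.L N.tx N.rx) (q : ℕ)
    (s : Σ l : Fin N.L, Fin (D.M l)) : ℝ :=
  if q = N.Q then quadForm (N.Wdest s.1) (D.r s)
  else quadForm (sandwich (N.HQ s.1 * N.B F (q + 1) N.Q) (N.W (q + 1))) (D.r s)

/-- The vectors `n̂_q`, `0 ≤ q ≤ Q`. -/
def revNoise (N : RelayNetwork) (F : N.Precoders) (D : IFN.Streams N.L N.tx N.rx) (q : ℕ)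
    (s : Σ l : Fin N.L, Fin (D.M l)) : ℝ :=
  if q = 0 then quadForm (N.Whatsrc s.1) (D.t s)
  else quadForm (sandwich ((N.H0 s.1)ᴴ * (N.B F 1 q)ᴴ) (N.What q)) (D.t s)

/-- `a_{q,q'} = n_qᵀ (D⁻¹ - Ψᵀ)⁻¹ n̂_{q'}`. -/
def a (N : RelayNetwork) (F : N.Precoders) (D : IFN.Streams N.L N.tx N.rx) (q q' : ℕ) : ℝ :=
  N.fwdNoise F D q ⬝ᵥ (D.powerMatrix N.φ (N.channel F) (N.noise F) *ᵥ N.revNoise F D q')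

/-- The matrix `A`, with rows and columns numbered from `0` to `Q`. -/
def scalingMatrix (N : RelayNetwork) (S : N.Cov) (F : N.Precoders)
    (D : IFN.Streams N.L N.tx N.rx) : Matrix (Fin (N.Q + 1)) (Fin (N.Q + 1)) ℝ :=
  fun i j =>
    (N.a F D i j + if i < j then N.b F (i + 1) j else 0) / N.txCost S F i

/-- `d` is an eigenvector of `A` for its maximum eigenvalue, with last component scaled to `1`. -/
def IsDominantEigenvector {n : ℕ} (A : Matrix (Fin (n + 1)) (Fin (n + 1)) ℝ)
    (d : Fin (n + 1) → ℝ) : Prop :=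
  ∃ mu : ℝ, IsGreatest {x : ℝ | Module.End.HasEigenvalue (Matrix.toLin' A) x} mu ∧
    A *ᵥ d = mu • d ∧ d (Fin.last n) = 1

/-- The entry `d̃_q`, `1 ≤ q ≤ Q + 1`, of a scaling vector. -/
def entry (N : RelayNetwork) (d : Fin (N.Q + 1) → ℝ) (q : ℕ) : ℝ :=
  d (Fin.ofNat (N.Q + 1) (q - 1))

/-- `Ŵ'_l(d) = ∑_q H_0^l† B_{1,q}† d_{q+1} Ŵ_q B_{1,q} H_0^l + d_1 Ŵ_0^l`. -/
def scaledDualNoise (N : RelayNetwork) (F : N.Precoders) (d : Fin (N.Q + 1) → ℝ) (l : Fin N.L) :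
    Matrix (Fin (N.tx l)) (Fin (N.tx l)) ℂ :=
  ∑ q ∈ Finset.Icc 1 N.Q,
      sandwich ((N.H0 l)ᴴ * (N.B F 1 q)ᴴ) (N.entry d (q + 1) • N.What q)
    + N.entry d 1 • N.Whatsrc l

/-- Input covariances of the Type II dual transformation. -/
def typeIICov (N : RelayNetwork) (F : N.Precoders) (D : IFN.Streams N.L N.tx N.rx)
    (d : Fin (N.Q + 1) → ℝ) : N.DualCov :=
  D.covTransform N.φ (N.channel F) (N.noise F) (N.scaledDualNoise F d)

/-- Relay precoders of the Type II dual transformation: `c̃_q F_q†` with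
`c̃_q = √(d̃_{q+1} / d̃_q)`; for `q = Q` this is `1 / √d̃_Q`, as `d̃_{Q+1} = 1`. -/
def typeIIPrecoders (N : RelayNetwork) (F : N.Precoders) (d : Fin (N.Q + 1) → ℝ) : N.Precoders :=
  fun q j => Real.sqrt (N.entry d (q + 1) / N.entry d q) • (F q j)ᴴ

end RelayNetwork

end

/-! For fixed precoders the relay network is a single-hop interference network. Number the hops `0,
…, Q`. Its noise is `∑ i, Vf i`, one summand per later noise source. The cost of hop `j` is `∑ₗ tr
(S l * Vr j l)` plus the forwarded noise `∑_{i<j} b i j`. The dual network has the same data with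
`Vf` and `Vr` exchanged and the hops reversed.

Rates: with MMSE receivers and successive cancellation the log-determinant splits into `∑ log (1 +
SINR)`. The stream powers satisfy `(D⁻¹ - Ψ) p = n` with `p, n > 0`, which makes `D⁻¹ - Ψ` an
M-matrix, so `(D⁻¹ - Ψᵀ) q = n̂` has a positive solution whenever `n̂ > 0`. Sending along `r` with
powers `q`, receiving along `t` and cancelling in the opposite order yields the same SINRs. The
log-determinant is at least the rate of these receivers, by Cauchy–Schwarz
(`IFN.IsDecomposition.rate_le_rate_covTransform`).

Costs: weight the reverse noise as `∑ j, d j • Vr j` and rescale the precoders by ratios of the `d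
j`. The ratios telescope, so the dual cost of hop `i` becomes `(∑ j, (a i j + [i<j] b i j) * d j) /
d i`. It equals `P i`, the original cost of hop `i`, for all `i` exactly when `A d = d`. Transposing
the linear system gives `nᵀ (D⁻¹ - Ψᵀ)⁻¹ n̂ = pᵀ n̂`, so summing the numerators of `A` down column
`j` gives the cost of hop `j`; that is, `P` is a positive left eigenvector of `A` for the eigenvalue
`1`. Nonzero precoders and a nonzero input make the entries along the cycle `0 → 1 → ⋯ → Q → 0`
positive. Perron–Frobenius (`exists_dominantEigenvector`) then makes `1` the largest eigenvalue and
`d` positive and unique. This is `IFN.IsDecomposition.exists_scaling`.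

Equality of the regions needs only an inequality of rates in each direction; the converse applies
the same single-hop result to the reversed data. If the input or some precoder vanishes, all rates
are zero and the zero strategy suffices. -/

section LinearAlgebra

/-! ### Quadratic forms, congruences and traces of positive matrices -/

theorem quadForm_add {n : ℕ} (A B : Matrix (Fin n) (Fin n) ℂ) (v : Fin n → ℂ) :
    quadForm (A + B) v = quadForm A v + quadForm B v := by
  simp [quadForm, add_mulVec, dotProduct_add]

theorem quadForm_smul {n : ℕ} (c : ℝ) (A : Matrix (Fin n) (Fin n) ℂ) (v : Fin n → ℂ) :
    quadForm (c • A) v = c * quadForm A v := by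
  simp [quadForm, smul_mulVec, dotProduct_smul]

theorem quadForm_zero {n : ℕ} (v : Fin n → ℂ) :
    quadForm (0 : Matrix (Fin n) (Fin n) ℂ) v = 0 := by
  simp [quadForm]

theorem quadForm_sum {n : ℕ} {ι : Type*} (s : Finset ι) (A : ι → Matrix (Fin n) (Fin n) ℂ)
    (v : Fin n → ℂ) : quadForm (∑ i ∈ s, A i) v = ∑ i ∈ s, quadForm (A i) v := by
  classical
  induction s using Finset.induction_on with
  | empty => simp [quadForm_zero]
  | insert i s hi ih => rw [Finset.sum_insert hi, Finset.sum_insert hi, quadForm_add, ih]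

theorem quadForm_nonneg {n : ℕ} {A : Matrix (Fin n) (Fin n) ℂ} (hA : A.PosSemidef)
    (v : Fin n → ℂ) : 0 ≤ quadForm A v :=
  hA.re_dotProduct_nonneg v

theorem ofReal_quadForm {n : ℕ} {A : Matrix (Fin n) (Fin n) ℂ} (hA : A.PosSemidef)
    (v : Fin n → ℂ) : (quadForm A v : ℂ) = star v ⬝ᵥ (A *ᵥ v) :=
  (Complex.eq_re_of_ofReal_le (r := 0) (by simpa using hA.dotProduct_mulVec_nonneg v)).symm

theorem quadForm_pos {n : ℕ} {A : Matrix (Fin n) (Fin n) ℂ} (hA : A.PosDef)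
    {v : Fin n → ℂ} (hv : v ≠ 0) : 0 < quadForm A v := by
  have h := hA.dotProduct_mulVec_pos hv
  exact (Complex.lt_def.1 h).1

theorem ne_zero_of_unit {n : ℕ} {v : Fin n → ℂ} (hv : star v ⬝ᵥ v = 1) : v ≠ 0 := by
  rintro rfl
  simp at hv

theorem rankOne_posSemidef {n : ℕ} (v : Fin n → ℂ) : (rankOne v).PosSemidef :=
  posSemidef_vecMulVec_self_star v

theorem sandwich_posSemidef {m n : Type*} [Fintype n] [Fintype m] (M : Matrix m n ℂ) {X : Matrix n n ℂ}
    (hX : X.PosSemidef) : (sandwich M X).PosSemidef :=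
  hX.mul_mul_conjTranspose_same M

theorem smul_posSemidef {n : Type*} [Fintype n] {X : Matrix n n ℂ} (hX : X.PosSemidef) {c : ℝ}
    (hc : 0 ≤ c) : (c • X).PosSemidef := by
  exact hX.smul hc

theorem smul_posDef {n : Type*} [Fintype n] {X : Matrix n n ℂ} (hX : X.PosDef) {c : ℝ}
    (hc : 0 < c) : (c • X).PosDef := by
  exact hX.smul hc

theorem sandwich_zero {m n : Type*} [Fintype n] (M : Matrix m n ℂ) :
    sandwich M (0 : Matrix n n ℂ) = 0 := by
  simp [sandwich]

theorem zero_sandwich {m n : Type*} [Fintype n] (X : Matrix n n ℂ) :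
    sandwich (0 : Matrix m n ℂ) X = 0 := by
  simp [sandwich]

theorem sandwich_smul {m n : Type*} [Fintype n] (M : Matrix m n ℂ) (c : ℝ) (X : Matrix n n ℂ) :
    sandwich M (c • X) = c • sandwich M X := by
  simp [sandwich]

theorem smul_sandwich {m n : Type*} [Fintype n] (M : Matrix m n ℂ) (c : ℝ) (X : Matrix n n ℂ) :
    sandwich (c • M) X = c ^ 2 • sandwich M X := by
  simp [sandwich, smul_smul, sq]

theorem sqrt_smul_sandwich {m n : Type*} [Fintype n] (M : Matrix m n ℂ) {c : ℝ} (hc : 0 ≤ c)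
    (X : Matrix n n ℂ) : sandwich (Real.sqrt c • M) X = c • sandwich M X := by
  rw [smul_sandwich, Real.sq_sqrt hc]

theorem sandwich_sum {m n ι : Type*} [Fintype n] (M : Matrix m n ℂ) (s : Finset ι)
    (X : ι → Matrix n n ℂ) : sandwich M (∑ i ∈ s, X i) = ∑ i ∈ s, sandwich M (X i) := by
  simp [sandwich, Matrix.mul_sum, Matrix.sum_mul]

theorem sandwich_rankOne {m n : ℕ} (M : Matrix (Fin m) (Fin n) ℂ) (v : Fin n → ℂ) :
    sandwich M (rankOne v) = rankOne (M *ᵥ v) := by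
  rw [sandwich, rankOne, rankOne, mul_vecMulVec, vecMulVec_mul, star_mulVec]

theorem quadForm_rankOne {n : ℕ} (v r : Fin n → ℂ) :
    quadForm (rankOne v) r = ‖star r ⬝ᵥ v‖ ^ 2 := by
  have h : star v ⬝ᵥ r = star (star r ⬝ᵥ v) := by
    rw [star_dotProduct]
  rw [quadForm, rankOne, vecMulVec_mulVec, dotProduct_smul, h]
  rw [Complex.star_def, op_smul_eq_mul, Complex.mul_conj, Complex.normSq_eq_norm_sq,
    Complex.ofReal_re]

theorem norm_star_dotProduct_comm {n : ℕ} (v w : Fin n → ℂ) :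
    ‖star v ⬝ᵥ w‖ = ‖star w ⬝ᵥ v‖ := by
  rw [← norm_star (star v ⬝ᵥ w), ← star_dotProduct]

theorem trace_rankOne_mul {n : ℕ} (v : Fin n → ℂ) (A : Matrix (Fin n) (Fin n) ℂ) :
    (rankOne v * A).trace.re = quadForm A v := by
  rw [rankOne, vecMulVec_mul, trace_vecMulVec, quadForm, dotProduct_comm, dotProduct_mulVec]

theorem trace_sum_rankOne_mul {n : ℕ} {ι : Type*} (s : Finset ι) (p : ι → ℝ) (t : ι → Fin n → ℂ)
    (A : Matrix (Fin n) (Fin n) ℂ) :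
    ((∑ i ∈ s, p i • rankOne (t i)) * A).trace.re = ∑ i ∈ s, p i * quadForm A (t i) := by
  rw [Matrix.sum_mul, trace_sum, Complex.re_sum]
  exact Finset.sum_congr rfl fun i _ => by
    rw [smul_mul, trace_smul, Complex.smul_re, trace_rankOne_mul, smul_eq_mul]

theorem trace_sandwich_mul {m n : Type*} [Fintype n] [Fintype m] (M : Matrix m n ℂ)
    (X : Matrix n n ℂ) (Y : Matrix m m ℂ) :
    (sandwich M X * Y).trace = (X * sandwich Mᴴ Y).trace := by
  simp only [sandwich, conjTranspose_conjTranspose]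
  rw [Matrix.mul_assoc, Matrix.mul_assoc, Matrix.trace_mul_comm]
  simp only [Matrix.mul_assoc]

theorem Matrix.PosSemidef.exists_conjTranspose_mul_self {n : Type*} [Fintype n] {X : Matrix n n ℂ}
    (hX : X.PosSemidef) : ∃ C : Matrix n n ℂ, X = Cᴴ * C := by
  classical
  open scoped MatrixOrder in
  exact CStarAlgebra.nonneg_iff_eq_star_mul_self.1 (Matrix.nonneg_iff_posSemidef.2 hX)

theorem trace_mul_re_nonneg {n : Type*} [Fintype n] {X Y : Matrix n n ℂ} (hX : X.PosSemidef)
    (hY : Y.PosSemidef) : 0 ≤ (X * Y).trace.re := by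
  obtain ⟨C, rfl⟩ := PosSemidef.exists_conjTranspose_mul_self hX
  rw [Matrix.mul_assoc, trace_mul_comm]
  exact (Complex.le_def.1 (hY.mul_mul_conjTranspose_same C).trace_nonneg).1

/-- With `X = Cᴴ C` and `Y = Eᴴ E` the trace is the squared Frobenius norm of `C Eᴴ`. If it vanishes
then `C Y = 0`, and invertibility of `Y` gives `C = 0`. -/
theorem trace_mul_re_pos {n : Type*} [Fintype n] {X Y : Matrix n n ℂ} (hX : X.PosSemidef)
    (hX0 : X ≠ 0) (hY : Y.PosDef) : 0 < (X * Y).trace.re := by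
  classical
  obtain ⟨C, rfl⟩ := PosSemidef.exists_conjTranspose_mul_self hX
  refine lt_of_le_of_ne (trace_mul_re_nonneg hX hY.posSemidef) fun h0 => hX0 ?_
  rw [Matrix.mul_assoc, trace_mul_comm] at h0
  have h1 := (hY.posSemidef.mul_mul_conjTranspose_same C).trace_nonneg
  have h2 : (C * Y * Cᴴ).trace = 0 :=
    Complex.ext h0.symm (Complex.le_def.1 h1).2.symm
  obtain ⟨E, hE⟩ := PosSemidef.exists_conjTranspose_mul_self hY.posSemidef
  have h3 : (C * Eᴴ) * (C * Eᴴ)ᴴ = C * Y * Cᴴ := by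
    rw [hE, conjTranspose_mul, conjTranspose_conjTranspose]
    simp only [Matrix.mul_assoc]
  rw [← h3, trace_mul_conjTranspose_self_eq_zero_iff] at h2
  have h4 : C * Y = 0 := by rw [hE, ← Matrix.mul_assoc, h2, Matrix.zero_mul]
  have h5 : C = 0 := by
    rw [← Matrix.mul_one C, ← mul_nonsing_inv Y ((isUnit_iff_isUnit_det _).1 hY.isUnit),
      ← Matrix.mul_assoc, h4, Matrix.zero_mul]
  rw [h5, Matrix.mul_zero]

theorem Matrix.PosDef.mulVec_inv_mulVec {n : ℕ} {A : Matrix (Fin n) (Fin n) ℂ} (hA : A.PosDef)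
    (h : Fin n → ℂ) : A *ᵥ (A⁻¹ *ᵥ h) = h := by
  rw [mulVec_mulVec, mul_nonsing_inv _ ((isUnit_iff_isUnit_det _).1 hA.isUnit), one_mulVec]

theorem Matrix.PosDef.star_inv_mulVec_dotProduct {n : ℕ} {A : Matrix (Fin n) (Fin n) ℂ} (hA : A.PosDef)
    (h w : Fin n → ℂ) : star (A⁻¹ *ᵥ h) ⬝ᵥ w = star h ⬝ᵥ (A⁻¹ *ᵥ w) := by
  rw [star_mulVec, hA.inv.isHermitian.eq, dotProduct_mulVec]

/-- Cauchy–Schwarz for a positive definite form and its inverse. -/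
theorem norm_sq_dotProduct_le {n : ℕ} {A : Matrix (Fin n) (Fin n) ℂ} (hA : A.PosDef)
    (t h : Fin n → ℂ) : ‖star t ⬝ᵥ h‖ ^ 2 ≤ quadForm A t * quadForm A⁻¹ h := by
  by_cases hh : h = 0
  · subst hh; simp [quadForm]
  have hpos := quadForm_pos hA.inv hh
  set β := quadForm A⁻¹ h with hβ
  set s := star h ⬝ᵥ t with hs
  have hb : (β : ℂ) = star h ⬝ᵥ (A⁻¹ *ᵥ h) := ofReal_quadForm hA.inv.posSemidef h
  have hst : star t ⬝ᵥ h = star s := by rw [hs, ← star_dotProduct]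
  -- This vector is `β` times the part of `t` that is `A`-orthogonal to `A⁻¹ h`; the factor `β`
  -- avoids a division.
  have hnn := quadForm_nonneg hA.posSemidef ((β : ℂ) • t - s • (A⁻¹ *ᵥ h))
  have hAt : star (A⁻¹ *ᵥ h) ⬝ᵥ (A *ᵥ t) = s := by
    rw [PosDef.star_inv_mulVec_dotProduct hA, mulVec_mulVec,
      nonsing_inv_mul _ ((isUnit_iff_isUnit_det _).1 hA.isUnit), one_mulVec]
  have hAh : star (A⁻¹ *ᵥ h) ⬝ᵥ h = β := by
    rw [PosDef.star_inv_mulVec_dotProduct hA, hb]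
  have key : quadForm A ((β : ℂ) • t - s • (A⁻¹ *ᵥ h)) = β * (β * quadForm A t - ‖s‖ ^ 2) := by
    apply Complex.ofReal_injective
    have hns : ((‖s‖ ^ 2 : ℝ) : ℂ) = s * star s := by
      rw [Complex.star_def, Complex.mul_conj, Complex.normSq_eq_norm_sq]
    rw [ofReal_quadForm hA.posSemidef]
    push_cast [ofReal_quadForm hA.posSemidef]
    push_cast at hns
    rw [hns]
    simp only [mulVec_sub, mulVec_smul, PosDef.mulVec_inv_mulVec hA, star_sub, star_smul,
      sub_dotProduct, dotProduct_sub, smul_dotProduct, dotProduct_smul, smul_eq_mul, hst, hAt, hAh,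
      Complex.star_def, Complex.conj_ofReal]
    ring
  rw [key] at hnn
  have := nonneg_of_mul_nonneg_right hnn hpos
  rw [hst, norm_star]
  linarith

/-- Equality in Cauchy–Schwarz for the vectors proportional to `A⁻¹ h`. -/
theorem norm_sq_dotProduct_inv {n : ℕ} {A : Matrix (Fin n) (Fin n) ℂ} (hA : A.PosDef)
    (α : ℂ) (h : Fin n → ℂ) :
    ‖star (α • (A⁻¹ *ᵥ h)) ⬝ᵥ h‖ ^ 2
      = quadForm A (α • (A⁻¹ *ᵥ h)) * quadForm A⁻¹ h := by
  apply Complex.ofReal_injective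
  push_cast [ofReal_quadForm hA.posSemidef, ofReal_quadForm hA.inv.posSemidef]
  simp only [mulVec_smul, PosDef.mulVec_inv_mulVec hA, star_smul, smul_dotProduct, dotProduct_smul,
    PosDef.star_inv_mulVec_dotProduct hA, ← ofReal_quadForm hA.inv.posSemidef, smul_eq_mul, norm_mul,
    norm_star, Complex.norm_real, mul_pow, Complex.ofReal_mul]
  have hns : ((‖α‖ : ℂ)) ^ 2 = α * star α := by
    rw [Complex.star_def, Complex.mul_conj, Complex.normSq_eq_norm_sq, Complex.ofReal_pow]
  have h2 : ((‖quadForm A⁻¹ h‖ : ℝ) : ℂ) ^ 2 = (quadForm A⁻¹ h : ℂ) ^ 2 := by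
    rw [Real.norm_eq_abs, ← Complex.ofReal_pow, sq_abs, Complex.ofReal_pow]
  rw [hns, h2]
  ring

/-! ### The log-determinant as a sum over successively decoded streams -/

/-- Repeated matrix determinant lemma: removing the rank-one term of largest index leaves a factor
that sees only the terms of smaller index. -/
theorem det_add_sum_rankOne {n : ℕ} {ι : Type*} [LinearOrder ι]
    {A : Matrix (Fin n) (Fin n) ℂ} (hA : A.PosDef) (p : ι → ℝ) (hp : ∀ i, 0 ≤ p i)
    (g : ι → Fin n → ℂ) (s : Finset ι) :
    (A + ∑ i ∈ s, p i • rankOne (g i)).det = A.det *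
      ((∏ m ∈ s, (1 + p m * quadForm (A + ∑ i ∈ s with i < m, p i • rankOne (g i))⁻¹ (g m)) : ℝ) : ℂ)
    := by
  induction s using Finset.induction_on_max with
  | empty => simp
  | insert m s hm ih =>
    have hms : m ∉ s := fun h => lt_irrefl _ (hm m h)
    have hpd : (A + ∑ i ∈ s, p i • rankOne (g i)).PosDef := hA.add_posSemidef
      (posSemidef_sum _ fun i _ => smul_posSemidef (rankOne_posSemidef _) (hp i))
    have h1 : (insert m s).filter (· < m) = s := by
      ext i; simp only [Finset.mem_filter, Finset.mem_insert]
      constructor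
      · rintro ⟨rfl | h, h'⟩
        · exact absurd h' (lt_irrefl _)
        · exact h
      · intro h; exact ⟨Or.inr h, hm i h⟩
    have h2 : ∀ k ∈ s, (insert m s).filter (· < k) = s.filter (· < k) := by
      intro k hk
      rw [Finset.filter_insert, if_neg (not_lt.2 (hm k hk).le)]
    rw [Finset.sum_insert hms, Finset.prod_insert hms, h1,
      Finset.prod_congr rfl (fun k hk => by rw [h2 k hk]), Complex.ofReal_mul, mul_left_comm, ← ih,
      add_comm (p m • _), ← add_assoc]
    have h3 : p m • rankOne (g m) = replicateCol Unit ((p m : ℂ) • g m) * replicateRow Unit (star (g m)) := by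
      ext i j
      simp [rankOne, vecMulVec, Matrix.mul_apply, mul_assoc]
    rw [h3, det_add_replicateCol_mul_replicateRow ((isUnit_iff_isUnit_det _).1 hpd.isUnit), mul_comm _ (det _)]
    congr 1
    rw [det_unique, Matrix.add_apply, Matrix.one_apply_eq, ← replicateRow_vecMul,
      replicateRow_mul_replicateCol_apply, dotProduct_smul, ← dotProduct_mulVec, Complex.ofReal_add,
      Complex.ofReal_mul, ofReal_quadForm hpd.inv.posSemidef, Complex.ofReal_one, smul_eq_mul]

/-- The chain rule for mutual information: after division by `A.det`, each factor is one plus the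
best SINR of a stream that still sees the streams before it. -/
theorem log_det_one_add {n : ℕ} {ι : Type*} [LinearOrder ι] [Fintype ι]
    {A : Matrix (Fin n) (Fin n) ℂ} (hA : A.PosDef) (p : ι → ℝ) (hp : ∀ i, 0 ≤ p i)
    (g : ι → Fin n → ℂ) :
    Real.log (1 + (∑ i, p i • rankOne (g i)) * A⁻¹).det.re =
      ∑ m, Real.log (1 + p m * quadForm (A + ∑ i with i < m, p i • rankOne (g i))⁻¹ (g m)) := by
  have hu : IsUnit A.det := (isUnit_iff_isUnit_det _).1 hA.isUnit
  have hpd : ∀ s : Finset ι, (A + ∑ i ∈ s, p i • rankOne (g i)).PosDef := fun s => hA.add_posSemidef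
      (posSemidef_sum _ fun i _ => smul_posSemidef (rankOne_posSemidef _) (hp i))
  have h1 : (1 + (∑ i, p i • rankOne (g i)) * A⁻¹).det * A.det
      = (A + ∑ i, p i • rankOne (g i)).det := by
    rw [← det_mul, Matrix.add_mul, Matrix.mul_assoc, nonsing_inv_mul _ hu]
    simp
  rw [det_add_sum_rankOne hA p hp, mul_comm] at h1
  rw [mul_left_cancel₀ hu.ne_zero h1, Complex.ofReal_re, Real.log_prod]
  intro m _
  have := mul_nonneg (hp m) (quadForm_nonneg (hpd {i | i < m}).inv.posSemidef (g m))
  positivity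

/-! ### M-matrices -/

/-- A matrix with nonpositive off-diagonal entries that maps some positive vector to a positive
vector is inverse-monotone. -/
theorem nonneg_of_mulVec_nonneg {ι : Type*} [Fintype ι] {M : Matrix ι ι ℝ}
    (hM : ∀ i j, i ≠ j → M i j ≤ 0) {x : ι → ℝ} (hx : ∀ i, 0 < x i)
    (hMx : ∀ i, 0 < (M *ᵥ x) i) {z : ι → ℝ} (hz : ∀ i, 0 ≤ (M *ᵥ z) i) (i : ι) : 0 ≤ z i := by
  classical
  -- Let `c` be the least ratio, attained at `k`. Then `z - c x` is nonnegative and vanishes at `k`,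
  -- so row `k` gives `(M z) k ≤ c (M x) k`, which is negative if `c` is.
  obtain ⟨k, -, hk⟩ := Finset.exists_min_image Finset.univ (fun i => z i / x i) ⟨i, Finset.mem_univ i⟩
  have key : ∀ j, z k / x k * x j ≤ z j := fun j => by
    rw [← le_div_iff₀ (hx j)]; exact hk j (Finset.mem_univ j)
  by_contra hneg
  have hc : z k / x k < 0 :=
    lt_of_le_of_lt (hk i (Finset.mem_univ i)) (div_neg_of_neg_of_pos (not_le.1 hneg) (hx i))
  have h1 : (M *ᵥ z) k ≤ z k / x k * (M *ᵥ x) k := by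
    simp only [mulVec, dotProduct, Finset.mul_sum]
    refine Finset.sum_le_sum fun j _ => ?_
    by_cases hj : k = j
    · subst hj
      have := (hx k).ne'
      apply le_of_eq; field_simp
    · nlinarith [mul_le_mul_of_nonpos_left (key j) (hM k j hj)]
  exact absurd (hz k) (not_le.2 (h1.trans_lt (mul_neg_of_neg_of_pos hc (hMx k))))

/-- Inverse-monotonicity applies to a kernel vector and to its negative, so the vector is zero. -/
theorem isUnit_det_of_mulVec_pos {ι : Type*} [Fintype ι] [DecidableEq ι] {M : Matrix ι ι ℝ}
    (hM : ∀ i j, i ≠ j → M i j ≤ 0) {x : ι → ℝ} (hx : ∀ i, 0 < x i)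
    (hMx : ∀ i, 0 < (M *ᵥ x) i) : IsUnit M.det := by
  rw [isUnit_iff_ne_zero]
  intro h0
  obtain ⟨v, hv, hv0⟩ := Matrix.exists_mulVec_eq_zero_iff.2 h0
  apply hv
  ext i
  refine le_antisymm ?_ ?_
  · have := nonneg_of_mulVec_nonneg hM hx hMx (z := -v) (by simp [mulVec_neg, hv0]) i
    simpa using this
  · exact nonneg_of_mulVec_nonneg hM hx hMx (z := v) (by simp [hv0]) i

theorem inv_nonneg_of_mulVec_pos {ι : Type*} [Fintype ι] [DecidableEq ι] {M : Matrix ι ι ℝ}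
    (hM : ∀ i j, i ≠ j → M i j ≤ 0) {x : ι → ℝ} (hx : ∀ i, 0 < x i)
    (hMx : ∀ i, 0 < (M *ᵥ x) i) (i j : ι) : 0 ≤ M⁻¹ i j := by
  have hu := isUnit_det_of_mulVec_pos hM hx hMx
  have := nonneg_of_mulVec_nonneg hM hx hMx (z := M⁻¹.col j) (by
    intro k
    rw [← mulVec_single_one, mulVec_mulVec, mul_nonsing_inv _ hu, one_mulVec]
    by_cases h : k = j <;> simp [h]) i
  exact this

/-- A positive semidefinite matrix is a sum of positive multiples of `t t†` with unit vectors `t`. -/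
theorem Matrix.PosSemidef.exists_eq_sum_rankOne {n : ℕ} {X : Matrix (Fin n) (Fin n) ℂ}
    (hX : X.PosSemidef) : ∃ (M : ℕ) (p : Fin M → ℝ) (t : Fin M → Fin n → ℂ),
      (∀ m, 0 < p m) ∧ (∀ m, star (t m) ⬝ᵥ t m = 1) ∧ X = ∑ m, p m • rankOne (t m) := by
  have hsum : X = ∑ i, hX.1.eigenvalues i • rankOne (hX.1.eigenvectorBasis i).ofLp := by
    conv_lhs => rw [hX.1.spectral_theorem]
    ext i j
    simp [Unitary.conjStarAlgAut_apply, Matrix.mul_apply, Matrix.sum_apply, rankOne, vecMulVec,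
      diagonal_apply, star_apply]
    exact Finset.sum_congr rfl fun _ _ => by ring
  -- Zero eigenvalues are dropped because stream powers have to be strictly positive.
  let T := {i : Fin n // 0 < hX.1.eigenvalues i}
  let e : Fin (Fintype.card T) ≃ T := (Fintype.equivFin T).symm
  refine ⟨Fintype.card T, fun m => hX.1.eigenvalues (e m),
    fun m => (hX.1.eigenvectorBasis (e m)).ofLp, fun m => (e m).2, fun m => ?_, ?_⟩
  · have := hX.1.eigenvectorBasis.orthonormal.1 (e m)
    rw [← dotProduct_comm, ← EuclideanSpace.inner_eq_star_dotProduct, inner_self_eq_norm_sq_to_K, this]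
    simp
  · rw [e.sum_comp (fun i : T => hX.1.eigenvalues i • rankOne (hX.1.eigenvectorBasis i).ofLp)]
    conv_lhs => rw [hsum]
    rw [← Fintype.sum_subtype_add_sum_subtype (fun i => 0 < hX.1.eigenvalues i), add_eq_left]
    refine Finset.sum_eq_zero fun i _ => ?_
    rw [le_antisymm (not_lt.1 i.2) (hX.eigenvalues_nonneg i), zero_smul]

theorem exists_unit_vec {n : ℕ} (hn : 0 < n) : ∃ v : Fin n → ℂ, star v ⬝ᵥ v = 1 :=
  ⟨Pi.single ⟨0, hn⟩ 1, by simp⟩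

theorem exists_unit_smul {n : ℕ} {v : Fin n → ℂ} (hv : v ≠ 0) :
    ∃ α : ℂ, star (α • v) ⬝ᵥ (α • v) = 1 := by
  have h0 : 0 < quadForm 1 v := quadForm_pos PosDef.one hv
  have h1 := ofReal_quadForm (n := n) PosSemidef.one v
  rw [one_mulVec] at h1
  refine ⟨((Real.sqrt (quadForm 1 v))⁻¹ : ℝ), ?_⟩
  rw [star_smul, smul_dotProduct, dotProduct_smul, ← h1, Complex.star_def, Complex.conj_ofReal,
    smul_eq_mul, smul_eq_mul, ← Complex.ofReal_mul, ← Complex.ofReal_mul, ← mul_assoc, ← mul_inv,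
    Real.mul_self_sqrt h0.le, inv_mul_cancel₀ h0.ne', Complex.ofReal_one]

/-! ### Perron–Frobenius for a matrix with a positive left eigenvector -/

/-- A positive left eigenvector with eigenvalue `1` of an irreducible nonnegative matrix determines
its dominant eigenvector: irreducibility enters as the cycle `0 → 1 → ⋯ → n → 0`. -/
theorem eq_zero_of_mulVec_eq_self {n : ℕ} {A : Matrix (Fin (n + 1)) (Fin (n + 1)) ℝ}
    (hA : ∀ i j, 0 ≤ A i j) (hlast : 0 < A (Fin.last n) 0)
    (hsucc : ∀ i : Fin n, 0 < A i.castSucc i.succ) {u : Fin (n + 1) → ℝ} (hu : ∀ i, 0 ≤ u i)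
    (hAu : A *ᵥ u = u) {i : Fin (n + 1)} (hi : u i = 0) : u = 0 := by
  -- If `u i = 0`, row `i` of `A u = u` is a vanishing sum of nonnegative terms. Zeros therefore
  -- spread along positive entries, and the cycle carries them everywhere.
  have step : ∀ i j, 0 < A i j → u i = 0 → u j = 0 := by
    intro i j hij hi
    have h := congrFun hAu i
    rw [hi, mulVec, dotProduct, Finset.sum_eq_zero_iff_of_nonneg
      (fun k _ => mul_nonneg (hA i k) (hu k))] at h
    exact (mul_eq_zero.1 (h j (Finset.mem_univ j))).resolve_left hij.ne'
  have up : ∀ i : Fin (n + 1), u i = 0 → u (Fin.last n) = 0 := by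
    intro i
    induction i using Fin.reverseInduction with
    | last => exact id
    | cast i ih => exact fun h => ih (step _ _ (hsucc i) h)
  have h0 : u 0 = 0 := step _ _ hlast (up i hi)
  ext j
  induction j using Fin.induction with
  | zero => exact h0
  | succ j ih => exact step _ _ (hsucc j) ih

/-- The triangle inequality gives `|v| ≤ A |v|`. Both sides have the same pairing with `P`, and the
weights of `P` are positive, so no component can be strict. -/
theorem abs_mulVec_eq_self {n : ℕ} {A : Matrix (Fin n) (Fin n) ℝ}
    (hA : ∀ i j, 0 ≤ A i j) {P : Fin n → ℝ} (hP : ∀ i, 0 < P i) (hPA : P ᵥ* A = P)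
    {v : Fin n → ℝ} (hv : A *ᵥ v = v) : A *ᵥ (fun i => |v i|) = fun i => |v i| := by
  have h1 : ∀ i, |v i| ≤ (A *ᵥ fun i => |v i|) i := by
    intro i
    conv_lhs => rw [← hv]
    simp only [mulVec, dotProduct]
    refine (Finset.abs_sum_le_sum_abs _ _).trans (Finset.sum_le_sum fun j _ => ?_)
    rw [abs_mul, abs_of_nonneg (hA i j)]
  have h2 : P ⬝ᵥ (A *ᵥ fun i => |v i|) = P ⬝ᵥ fun i => |v i| := by
    rw [dotProduct_mulVec, hPA]
  have h3 : ∑ i, P i * ((A *ᵥ fun i => |v i|) i - |v i|) = 0 := by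
    simp only [mul_sub, Finset.sum_sub_distrib]
    exact sub_eq_zero.2 h2
  rw [Finset.sum_eq_zero_iff_of_nonneg
    (fun i _ => mul_nonneg (hP i).le (sub_nonneg.2 (h1 i)))] at h3
  ext i
  exact sub_eq_zero.1 ((mul_eq_zero.1 (h3 i (Finset.mem_univ i))).resolve_left (hP i).ne')

/-- Pairing `x |v| ≤ A |v|` with the left eigenvector gives `x (P · |v|) ≤ P · |v|`, where `P · |v|
> 0`. -/
theorem abs_eigenvalue_le_one {n : ℕ} {A : Matrix (Fin n) (Fin n) ℝ}
    (hA : ∀ i j, 0 ≤ A i j) {P : Fin n → ℝ} (hP : ∀ i, 0 < P i) (hPA : P ᵥ* A = P)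
    {v : Fin n → ℝ} (hv0 : v ≠ 0) {x : ℝ} (hv : A *ᵥ v = x • v) : x ≤ 1 := by
  have h1 : ∀ i, x * |v i| ≤ (A *ᵥ fun i => |v i|) i := by
    intro i
    have h := congrArg abs (congrFun hv i)
    rw [Pi.smul_apply, smul_eq_mul, abs_mul] at h
    refine (mul_le_mul_of_nonneg_right (le_abs_self x) (abs_nonneg _)).trans ?_
    rw [← h]
    simp only [mulVec, dotProduct]
    refine (Finset.abs_sum_le_sum_abs _ _).trans (Finset.sum_le_sum fun j _ => ?_)
    rw [abs_mul, abs_of_nonneg (hA i j)]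
  have h2 : P ⬝ᵥ (A *ᵥ fun i => |v i|) = P ⬝ᵥ fun i => |v i| := by
    rw [dotProduct_mulVec, hPA]
  obtain ⟨k, hk⟩ := Function.ne_iff.1 hv0
  have h3 : 0 < P ⬝ᵥ fun i => |v i| :=
    Finset.sum_pos' (fun i _ => mul_nonneg (hP i).le (abs_nonneg _))
      ⟨k, Finset.mem_univ k, mul_pos (hP k) (abs_pos.2 hk)⟩
  have h4 : x * (P ⬝ᵥ fun i => |v i|) ≤ 1 * (P ⬝ᵥ fun i => |v i|) := by
    conv_rhs => rw [one_mul, ← h2]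
    simp only [dotProduct, Finset.mul_sum]
    refine Finset.sum_le_sum fun i _ => ?_
    rw [mul_left_comm]
    exact mul_le_mul_of_nonneg_left (h1 i) (hP i).le
  exact le_of_mul_le_mul_right h4 h3

/-- Perron–Frobenius for a nonnegative matrix with a positive left eigenvector `P` of eigenvalue
`1` and positive entries along the cycle `0 → 1 → ⋯ → n → 0`. -/
theorem exists_dominantEigenvector {n : ℕ} {A : Matrix (Fin (n + 1)) (Fin (n + 1)) ℝ}
    (hA : ∀ i j, 0 ≤ A i j) (hlast : 0 < A (Fin.last n) 0)
    (hsucc : ∀ i : Fin n, 0 < A i.castSucc i.succ) {P : Fin (n + 1) → ℝ} (hP : ∀ i, 0 < P i)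
    (hPA : P ᵥ* A = P) :
    ∃ d, RelayNetwork.IsDominantEigenvector A d ∧ (∀ i, 0 < d i) ∧ A *ᵥ d = d ∧
      ∀ d', RelayNetwork.IsDominantEigenvector A d' → d' = d := by
  have hpos : ∀ {v : Fin (n + 1) → ℝ}, A *ᵥ v = v → v ≠ 0 → ∀ i, v i ≠ 0 := by
    intro v hv hv0 i hi
    apply hv0
    have := eq_zero_of_mulVec_eq_self hA hlast hsucc (fun i => abs_nonneg (v i))
      (abs_mulVec_eq_self hA hP hPA hv) (i := i) (by simp [hi])
    ext j
    exact abs_eq_zero.1 (congrFun this j)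
  obtain ⟨v, hv0, hv⟩ : ∃ v, v ≠ 0 ∧ A *ᵥ v = v := by
    -- The left eigenvector makes `A - 1` singular, hence there is also a right one, so far of
    -- unknown sign.
    have hP0 : P ≠ 0 := fun h => (hP 0).ne' (congrFun h 0)
    have hdet : (A - 1).det = 0 :=
      exists_vecMul_eq_zero_iff.1 ⟨P, hP0, by rw [vecMul_sub, hPA, vecMul_one, sub_self]⟩
    obtain ⟨v, hv0, hv⟩ := exists_mulVec_eq_zero_iff.2 hdet
    refine ⟨v, hv0, ?_⟩
    rwa [sub_mulVec, one_mulVec, sub_eq_zero] at hv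
  set w : Fin (n + 1) → ℝ := fun i => |v i| with hw
  have hAw : A *ᵥ w = w := abs_mulVec_eq_self hA hP hPA hv
  have hwpos : ∀ i, 0 < w i := fun i => abs_pos.2 (hpos hv hv0 i)
  set d : Fin (n + 1) → ℝ := (w (Fin.last n))⁻¹ • w with hd
  have hAd : A *ᵥ d = d := by rw [hd, mulVec_smul, hAw]
  have hdpos : ∀ i, 0 < d i := fun i => mul_pos (inv_pos.2 (hwpos _)) (hwpos i)
  have hdlast : d (Fin.last n) = 1 := inv_mul_cancel₀ (hwpos _).ne'
  have hgreat : IsGreatest {x : ℝ | Module.End.HasEigenvalue (Matrix.toLin' A) x} 1 := by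
    constructor
    · refine Module.End.hasEigenvalue_of_hasEigenvector (x := d) ⟨?_, ?_⟩
      · rw [Module.End.mem_eigenspace_iff, toLin'_apply, hAd, one_smul]
      · exact fun h => (hdpos 0).ne' (congrFun h 0)
    · intro x hx
      obtain ⟨u, hu⟩ := Module.End.HasEigenvalue.exists_hasEigenvector hx
      have h1 := hu.apply_eq_smul
      rw [toLin'_apply] at h1
      exact abs_eigenvalue_le_one hA hP hPA hu.2 h1
  refine ⟨d, ⟨1, hgreat, by rw [hAd, one_smul], hdlast⟩, hdpos, hAd, ?_⟩
  rintro d' ⟨mu, hmu, hd', hl⟩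
  rw [hmu.unique hgreat, one_smul] at hd'
  by_contra hne
  -- The normalisation makes the last component of `d' - d` zero, but a nonzero fixed vector has no
  -- zero component.
  refine hpos (v := d' - d) (by rw [mulVec_sub, hd', hAd]) (sub_ne_zero.2 hne) (Fin.last n) ?_
  simp [hl, hdlast]

end LinearAlgebra

/-! ### Single-hop duality: streams, SINRs and reverse powers -/

namespace IFN

section Hops

variable {L : ℕ} {tx rx : Fin L → ℕ} {φ : Matrix (Fin L) (Fin L) ℝ}
  {G : (l k : Fin L) → Matrix (Fin (rx l)) (Fin (tx k)) ℂ}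
  {V : (l : Fin L) → Matrix (Fin (rx l)) (Fin (rx l)) ℂ}
  {S : (l : Fin L) → Matrix (Fin (tx l)) (Fin (tx l)) ℂ}
  {D : Streams L tx rx}

theorem omega_posDef (hφ : ∀ l k, 0 ≤ φ l k) (hV : ∀ l, (V l).PosDef)
    (hS : ∀ l, (S l).PosSemidef) (l : Fin L) : (omega φ G V S l).PosDef :=
  (hV l).add_posSemidef
    (posSemidef_sum _ fun k _ => smul_posSemidef (sandwich_posSemidef _ (hS k)) (hφ l k))

theorem sum_streams_posSemidef {M : Fin L → ℕ} {p : (Σ l, Fin (M l)) → ℝ} (hp : ∀ s, 0 ≤ p s)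
    (t : (s : Σ l, Fin (M l)) → Fin (tx s.1) → ℂ) (l : Fin L) :
    (∑ m : Fin (M l), p ⟨l, m⟩ • rankOne (t ⟨l, m⟩) :
      Matrix (Fin (tx l)) (Fin (tx l)) ℂ).PosSemidef :=
  posSemidef_sum _ fun _ _ => smul_posSemidef (rankOne_posSemidef _) (hp _)

/-- Covariance seen at the receiver of link `l` while the streams in `s` are not cancelled. -/
theorem interference_posDef (hφ : ∀ l k, 0 ≤ φ l k) (hV : ∀ l, (V l).PosDef)
    (hS : ∀ l, (S l).PosSemidef) {M : Fin L → ℕ} {p : (Σ l, Fin (M l)) → ℝ} (hp : ∀ s, 0 ≤ p s)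
    (t : (s : Σ l, Fin (M l)) → Fin (tx s.1) → ℂ) (l : Fin L) (s : Finset (Fin (M l))) :
    (∑ i ∈ s, p ⟨l, i⟩ • sandwich (G l l) (rankOne (t ⟨l, i⟩)) + omega φ G V S l).PosDef :=
  (omega_posDef hφ hV hS l).posSemidef_add (posSemidef_sum _ fun _ _ =>
    smul_posSemidef (sandwich_posSemidef _ (rankOne_posSemidef _)) (hp _))

theorem quadForm_interference {M : Fin L → ℕ} {p : (Σ l, Fin (M l)) → ℝ}
    {t : (s : Σ l, Fin (M l)) → Fin (tx s.1) → ℂ}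
    (hS : ∀ l, S l = ∑ m : Fin (M l), p ⟨l, m⟩ • rankOne (t ⟨l, m⟩))
    (l : Fin L) (s : Finset (Fin (M l))) (v : Fin (rx l) → ℂ) :
    quadForm (∑ i ∈ s, p ⟨l, i⟩ • sandwich (G l l) (rankOne (t ⟨l, i⟩)) + omega φ G V S l) v
      = quadForm (V l) v + (∑ i ∈ s, p ⟨l, i⟩ * ‖star v ⬝ᵥ (G l l *ᵥ t ⟨l, i⟩)‖ ^ 2
        + ∑ k, φ l k * ∑ n, p ⟨k, n⟩ * ‖star v ⬝ᵥ (G l k *ᵥ t ⟨k, n⟩)‖ ^ 2) := by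
  have h : ∀ k, quadForm (sandwich (G l k) (S k)) v
      = ∑ n, p ⟨k, n⟩ * ‖star v ⬝ᵥ (G l k *ᵥ t ⟨k, n⟩)‖ ^ 2 := fun k => by
    rw [hS k, sandwich_sum, quadForm_sum]
    exact Finset.sum_congr rfl fun n _ => by
      rw [sandwich_smul, quadForm_smul, sandwich_rankOne, quadForm_rankOne]
  simp only [quadForm_add, quadForm_sum, quadForm_smul, sandwich_rankOne, quadForm_rankOne, omega, h]
  ring

theorem exists_isDecomposition (φ : Matrix (Fin L) (Fin L) ℝ)
    (G : (l k : Fin L) → Matrix (Fin (rx l)) (Fin (tx k)) ℂ)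
    (hφ : ∀ l k, 0 ≤ φ l k) (hV : ∀ l, (V l).PosDef)
    (hS : ∀ l, (S l).PosSemidef) (hrx : ∀ l, 0 < rx l) :
    ∃ D, IsDecomposition φ G V S D := by
  choose M p t hp ht hSt using fun l => PosSemidef.exists_eq_sum_rankOne (hS l)
  have hr : ∀ s : Σ l, Fin (M l), ∃ r : Fin (rx s.1) → ℂ, star r ⬝ᵥ r = 1 ∧
      (G s.1 s.1 *ᵥ t s.1 s.2 ≠ 0 → ∃ α : ℂ, r = α •
        ((∑ i with s.2 < i, p s.1 i • sandwich (G s.1 s.1) (rankOne (t s.1 i))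
          + omega φ G V S s.1)⁻¹ *ᵥ (G s.1 s.1 *ᵥ t s.1 s.2))) := by
    rintro ⟨l, m⟩
    by_cases h : G l l *ᵥ t l m = 0
    · obtain ⟨v, hv⟩ := exists_unit_vec (hrx l)
      exact ⟨v, hv, fun h' => absurd h h'⟩
    · have hpd := interference_posDef (G := G) hφ hV hS (M := M) (p := fun s => p s.1 s.2)
        (fun s => (hp s.1 s.2).le) (fun s => t s.1 s.2) l {i | m < i}
      obtain ⟨α, hα⟩ := exists_unit_smul (v := (∑ i with m < i, p l i •
        sandwich (G l l) (rankOne (t l i)) + omega φ G V S l)⁻¹ *ᵥ (G l l *ᵥ t l m)) (by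
          intro h0
          apply h
          rw [← PosDef.mulVec_inv_mulVec hpd (G l l *ᵥ t l m)]
          dsimp only
          rw [h0, mulVec_zero])
      exact ⟨_, hα, fun _ => ⟨α, rfl⟩⟩
  choose r hr1 hr2 using hr
  exact ⟨⟨M, fun s => p s.1 s.2, fun s => t s.1 s.2, r⟩,
    ⟨fun s => hp s.1 s.2, fun s => ht s.1 s.2, hSt, hr1, fun l m => hr2 ⟨l, m⟩⟩⟩

namespace Streams

theorem gain_nonneg (s s' : Σ l : Fin L, Fin (D.M l)) : 0 ≤ D.gain G s s' := sq_nonneg _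

theorem crosstalk_nonneg (hφ : ∀ l k, 0 ≤ φ l k) (s s' : Σ l : Fin L, Fin (D.M l)) :
    0 ≤ D.crosstalk φ G s s' := by
  unfold crosstalk
  split_ifs
  · exact gain_nonneg _ _
  · exact le_rfl
  · exact mul_nonneg (hφ _ _) (gain_nonneg _ _)

/-- The zero diagonal of `φ` turns the case distinction into a sum of an intra-link term and a
coupling term, the shape of the interference covariance. -/
theorem crosstalk_mk (hφ0 : ∀ l, φ l l = 0) (l k : Fin L) (m : Fin (D.M l)) (n : Fin (D.M k)) :
    D.crosstalk φ G ⟨l, m⟩ ⟨k, n⟩ = (if l = k then (if m.val < n.val then D.gain G ⟨l, m⟩ ⟨k, n⟩ else 0)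
      else 0) + φ l k * D.gain G ⟨l, m⟩ ⟨k, n⟩ := by
  simp only [crosstalk]
  by_cases h : l = k
  · subst h; simp [hφ0]
  · simp [h]

theorem crosstalk_mulVec (hφ0 : ∀ l, φ l l = 0) (x : (Σ l : Fin L, Fin (D.M l)) → ℝ) (l : Fin L)
    (m : Fin (D.M l)) : (D.crosstalk φ G *ᵥ x) ⟨l, m⟩ =
      ∑ i with m < i, x ⟨l, i⟩ * D.gain G ⟨l, m⟩ ⟨l, i⟩
        + ∑ k, φ l k * ∑ n, x ⟨k, n⟩ * D.gain G ⟨l, m⟩ ⟨k, n⟩ := by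
  rw [mulVec, dotProduct, Fintype.sum_sigma]
  simp only [crosstalk_mk hφ0, add_mul, Finset.sum_add_distrib]
  congr 1
  · rw [Finset.sum_eq_single l (fun k _ hk => by simp [hk.symm]) (by simp), Finset.sum_filter]
    refine Finset.sum_congr rfl fun i _ => ?_
    rw [if_pos rfl, ite_mul, zero_mul, mul_comm]
    rfl
  · exact Finset.sum_congr rfl fun k _ => by
      rw [Finset.mul_sum]
      exact Finset.sum_congr rfl fun n _ => by ring

/-- Transposition reverses the decoding order: a dual stream sees the streams of its own link with
smaller index, and the coupling matrix becomes `φᵀ`. -/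
theorem crosstalk_transpose_mulVec (hφ0 : ∀ l, φ l l = 0) (x : (Σ l : Fin L, Fin (D.M l)) → ℝ)
    (l : Fin L) (m : Fin (D.M l)) : ((D.crosstalk φ G)ᵀ *ᵥ x) ⟨l, m⟩ =
      ∑ i with i < m, x ⟨l, i⟩ * D.gain G ⟨l, i⟩ ⟨l, m⟩
        + ∑ k, φ k l * ∑ n, x ⟨k, n⟩ * D.gain G ⟨k, n⟩ ⟨l, m⟩ := by
  rw [mulVec, dotProduct, Fintype.sum_sigma]
  simp only [transpose_apply, crosstalk_mk hφ0, add_mul, Finset.sum_add_distrib]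
  congr 1
  · rw [Finset.sum_eq_single l (fun k _ hk => by simp [hk]) (by simp), Finset.sum_filter]
    refine Finset.sum_congr rfl fun i _ => ?_
    rw [if_pos rfl, ite_mul, zero_mul, mul_comm]
    rfl
  · exact Finset.sum_congr rfl fun k _ => by
      rw [Finset.mul_sum]
      exact Finset.sum_congr rfl fun n _ => by ring

end Streams

namespace IsDecomposition

theorem posSemidef (hD : IsDecomposition φ G V S D) (l : Fin L) : (S l).PosSemidef := by
  rw [hD.sum_eq l]
  exact sum_streams_posSemidef (fun s => (hD.p_pos s).le) _ l

theorem noisePower_eq (hD : IsDecomposition φ G V S D) (hφ0 : ∀ l, φ l l = 0) (l : Fin L)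
    (m : Fin (D.M l)) : D.noisePower φ G V ⟨l, m⟩ =
      quadForm (∑ i with m < i, D.p ⟨l, i⟩ • sandwich (G l l) (rankOne (D.t ⟨l, i⟩))
        + omega φ G V S l) (D.r ⟨l, m⟩) := by
  rw [quadForm_interference hD.sum_eq, Streams.noisePower, Streams.crosstalk_mulVec hφ0]
  rfl

theorem noise_pos (hD : IsDecomposition φ G V S D) (hV : ∀ l, (V l).PosDef)
    (s : Σ l : Fin L, Fin (D.M l)) : 0 < quadForm (V s.1) (D.r s) :=
  quadForm_pos (hV s.1) (ne_zero_of_unit (hD.r_unit s))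

theorem noisePower_pos (hD : IsDecomposition φ G V S D) (hφ : ∀ l k, 0 ≤ φ l k)
    (hV : ∀ l, (V l).PosDef) (s : Σ l : Fin L, Fin (D.M l)) : 0 < D.noisePower φ G V s :=
  add_pos_of_pos_of_nonneg (hD.noise_pos hV s) (Finset.sum_nonneg fun s' _ =>
    mul_nonneg (Streams.crosstalk_nonneg hφ s s') (hD.p_pos s').le)

/-- The gain cancels in `γ / gain`, so both branches of the definition equal `p / noisePower`, which
is positive even for a stream that does not reach its receiver. -/
theorem sinrMatrix_inv (hD : IsDecomposition φ G V S D) (hφ : ∀ l k, 0 ≤ φ l k)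
    (hV : ∀ l, (V l).PosDef) :
    (D.sinrMatrix φ G V)⁻¹ = diagonal fun s => D.noisePower φ G V s / D.p s := by
  have h : D.sinrMatrix φ G V = diagonal fun s => D.p s / D.noisePower φ G V s := by
    unfold Streams.sinrMatrix
    congr 1
    ext s
    split_ifs with h
    · rfl
    · rw [Streams.sinr]; field_simp
  apply inv_eq_right_inv
  rw [h, diagonal_mul_diagonal, ← diagonal_one]
  congr 1
  ext s
  have := (hD.p_pos s).ne'
  have := (hD.noisePower_pos hφ hV s).ne'
  field_simp

theorem offDiag_nonpos (hD : IsDecomposition φ G V S D) (hφ : ∀ l k, 0 ≤ φ l k)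
    (hV : ∀ l, (V l).PosDef) (s s' : Σ l : Fin L, Fin (D.M l)) (h : s ≠ s') :
    ((D.sinrMatrix φ G V)⁻¹ - D.crosstalk φ G) s s' ≤ 0 := by
  rw [hD.sinrMatrix_inv hφ hV, Matrix.sub_apply, diagonal_apply_ne _ h, zero_sub, neg_nonpos]
  exact Streams.crosstalk_nonneg hφ s s'

/-- The SINR definition as a linear system. The pair `p > 0`, `n > 0` certifies that `D⁻¹ - Ψ` is an
M-matrix. -/
theorem mulVec_power (hD : IsDecomposition φ G V S D) (hφ : ∀ l k, 0 ≤ φ l k)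
    (hV : ∀ l, (V l).PosDef) : ((D.sinrMatrix φ G V)⁻¹ - D.crosstalk φ G) *ᵥ D.p
      = fun s => quadForm (V s.1) (D.r s) := by
  ext s
  rw [hD.sinrMatrix_inv hφ hV, sub_mulVec, Pi.sub_apply, mulVec_diagonal,
    div_mul_cancel₀ _ (hD.p_pos s).ne', Streams.noisePower, add_sub_cancel_right]

theorem isUnit_det (hD : IsDecomposition φ G V S D) (hφ : ∀ l k, 0 ≤ φ l k)
    (hV : ∀ l, (V l).PosDef) : IsUnit ((D.sinrMatrix φ G V)⁻¹ - D.crosstalk φ G).det :=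
  isUnit_det_of_mulVec_pos (hD.offDiag_nonpos hφ hV) hD.p_pos fun s => by
    rw [hD.mulVec_power hφ hV]; exact hD.noise_pos hV s

theorem powerMatrix_eq (hD : IsDecomposition φ G V S D) (hφ : ∀ l k, 0 ≤ φ l k)
    (hV : ∀ l, (V l).PosDef) : D.powerMatrix φ G V
      = (((D.sinrMatrix φ G V)⁻¹ - D.crosstalk φ G)⁻¹)ᵀ := by
  rw [transpose_nonsing_inv, transpose_sub, hD.sinrMatrix_inv hφ hV, diagonal_transpose,
    ← hD.sinrMatrix_inv hφ hV, Streams.powerMatrix]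

theorem powerMatrix_nonneg (hD : IsDecomposition φ G V S D) (hφ : ∀ l k, 0 ≤ φ l k)
    (hV : ∀ l, (V l).PosDef) (s s' : Σ l : Fin L, Fin (D.M l)) : 0 ≤ D.powerMatrix φ G V s s' := by
  rw [hD.powerMatrix_eq hφ hV]
  exact inv_nonneg_of_mulVec_pos (hD.offDiag_nonpos hφ hV) hD.p_pos (fun s => by
    rw [hD.mulVec_power hφ hV]; exact hD.noise_pos hV s) s' s

/-- Moving the transposed inverse to the other side of the pairing leaves `(D⁻¹ - Ψ)⁻¹ n = p`. This
identity makes the original and dual costs balance. -/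
theorem noise_dotProduct_powerMatrix (hD : IsDecomposition φ G V S D) (hφ : ∀ l k, 0 ≤ φ l k)
    (hV : ∀ l, (V l).PosDef) (y : (Σ l : Fin L, Fin (D.M l)) → ℝ) :
    (fun s => quadForm (V s.1) (D.r s)) ⬝ᵥ (D.powerMatrix φ G V *ᵥ y) = D.p ⬝ᵥ y := by
  rw [dotProduct_mulVec, hD.powerMatrix_eq hφ hV, vecMul_transpose, ← hD.mulVec_power hφ hV,
    mulVec_mulVec, nonsing_inv_mul _ (hD.isUnit_det hφ hV), one_mulVec]

theorem powerMatrix_mulVec_nonneg (hD : IsDecomposition φ G V S D) (hφ : ∀ l k, 0 ≤ φ l k)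
    (hV : ∀ l, (V l).PosDef) {y : (Σ l : Fin L, Fin (D.M l)) → ℝ} (hy : ∀ s, 0 ≤ y s)
    (s : Σ l : Fin L, Fin (D.M l)) : 0 ≤ (D.powerMatrix φ G V *ᵥ y) s :=
  Finset.sum_nonneg fun s' _ => mul_nonneg (hD.powerMatrix_nonneg hφ hV s s') (hy s')

/-- For `y = n̂` the right side is the dual noise-plus-interference power after the receive vector
`t s`; the equation says that the dual stream has the original SINR. -/
theorem noisePower_mul_powerMatrix_mulVec (hD : IsDecomposition φ G V S D)
    (hφ : ∀ l k, 0 ≤ φ l k) (hV : ∀ l, (V l).PosDef) (y : (Σ l : Fin L, Fin (D.M l)) → ℝ)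
    (s : Σ l : Fin L, Fin (D.M l)) :
    D.noisePower φ G V s / D.p s * (D.powerMatrix φ G V *ᵥ y) s
      = y s + ((D.crosstalk φ G)ᵀ *ᵥ (D.powerMatrix φ G V *ᵥ y)) s := by
  have h : ((D.sinrMatrix φ G V)⁻¹ - (D.crosstalk φ G)ᵀ) *ᵥ (D.powerMatrix φ G V *ᵥ y) = y := by
    rw [mulVec_mulVec, Streams.powerMatrix, mul_nonsing_inv, one_mulVec]
    have h1 : (D.sinrMatrix φ G V)⁻¹ - (D.crosstalk φ G)ᵀ
        = ((D.sinrMatrix φ G V)⁻¹ - D.crosstalk φ G)ᵀ := by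
      rw [transpose_sub, hD.sinrMatrix_inv hφ hV, diagonal_transpose]
    rw [h1, det_transpose]
    exact hD.isUnit_det hφ hV
  have h2 := congrFun h s
  rw [sub_mulVec, Pi.sub_apply, hD.sinrMatrix_inv hφ hV, mulVec_diagonal] at h2
  linarith

theorem powerMatrix_mulVec_pos (hD : IsDecomposition φ G V S D) (hφ : ∀ l k, 0 ≤ φ l k)
    (hV : ∀ l, (V l).PosDef) {y : (Σ l : Fin L, Fin (D.M l)) → ℝ} (hy : ∀ s, 0 < y s)
    (s : Σ l : Fin L, Fin (D.M l)) : 0 < (D.powerMatrix φ G V *ᵥ y) s := by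
  have h1 := hD.noisePower_mul_powerMatrix_mulVec hφ hV y s
  have h2 : 0 ≤ ((D.crosstalk φ G)ᵀ *ᵥ (D.powerMatrix φ G V *ᵥ y)) s :=
    Finset.sum_nonneg fun s' _ => mul_nonneg (Streams.crosstalk_nonneg hφ s' s)
      (hD.powerMatrix_mulVec_nonneg hφ hV (fun s => (hy s).le) s')
  refine pos_of_mul_pos_right (a := D.noisePower φ G V s / D.p s) ?_
    (div_pos (hD.noisePower_pos hφ hV s) (hD.p_pos s)).le
  rw [h1]
  exact add_pos_of_pos_of_nonneg (hy s) h2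

theorem sinr_nonneg (hD : IsDecomposition φ G V S D) (hφ : ∀ l k, 0 ≤ φ l k)
    (hV : ∀ l, (V l).PosDef) (s : Σ l : Fin L, Fin (D.M l)) : 0 ≤ D.sinr φ G V s :=
  div_nonneg (mul_nonneg (hD.p_pos s).le (Streams.gain_nonneg s s)) (hD.noisePower_pos hφ hV s).le

theorem rate_eq_sum_sinr (hD : IsDecomposition φ G V S D) (hφ : ∀ l k, 0 ≤ φ l k)
    (hφ0 : ∀ l, φ l l = 0) (hV : ∀ l, (V l).PosDef) (l : Fin L) :
    rate φ G V S l = ∑ m, Real.log (1 + D.sinr φ G V ⟨l, m⟩) := by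
  have hS : sandwich (G l l) (S l) = ∑ m, D.p ⟨l, m⟩ • rankOne (G l l *ᵥ D.t ⟨l, m⟩) := by
    rw [hD.sum_eq l, sandwich_sum]
    exact Finset.sum_congr rfl fun m _ => by rw [sandwich_smul, sandwich_rankOne]
  -- The order is reversed because stream `m` here sees the streams `i > m`, while `log_det_one_add`
  -- keeps the smaller indices.
  have h := log_det_one_add (ι := (Fin (D.M l))ᵒᵈ) (omega_posDef (G := G) hφ hV hD.posSemidef l)
    (fun m => D.p ⟨l, m.ofDual⟩) (fun m => (hD.p_pos _).le) (fun m => G l l *ᵥ D.t ⟨l, m.ofDual⟩)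
  rw [rate, hS]
  refine h.trans (Finset.sum_congr rfl fun m _ => ?_)
  change Real.log (1 + D.p ⟨l, m⟩ * quadForm (omega φ G V S l + ∑ i : Fin (D.M l) with
    OrderDual.ofDual m < i, D.p ⟨l, i⟩ • rankOne (G l l *ᵥ D.t ⟨l, i⟩))⁻¹ (G l l *ᵥ D.t ⟨l, m⟩)) = _
  set A := omega φ G V S l + ∑ i : Fin (D.M l) with OrderDual.ofDual m < i,
    D.p ⟨l, i⟩ • rankOne (G l l *ᵥ D.t ⟨l, i⟩) with hA
  have hAeq : A = ∑ i : Fin (D.M l) with OrderDual.ofDual m < i,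
      D.p ⟨l, i⟩ • sandwich (G l l) (rankOne (D.t ⟨l, i⟩)) + omega φ G V S l := by
    rw [hA, add_comm]
    simp only [sandwich_rankOne]
  have hpd : A.PosDef := by
    rw [hAeq]
    exact interference_posDef hφ hV hD.posSemidef (fun s => (hD.p_pos s).le) _ _ _
  have hn : D.noisePower φ G V ⟨l, m⟩ = quadForm A (D.r ⟨l, m⟩) := by
    rw [hAeq]
    exact hD.noisePower_eq hφ0 l m
  congr 2
  rw [Streams.sinr, mul_div_assoc]
  congr 1
  by_cases h0 : G l l *ᵥ D.t ⟨l, m⟩ = 0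
  · simp [Streams.gain, h0, quadForm]
  -- The MMSE vector is proportional to `A⁻¹ G t`, the equality case of Cauchy–Schwarz, so its SINR
  -- is the optimal one.
  obtain ⟨α, hα⟩ := hD.r_mmse l m h0
  have hα' : D.r ⟨l, m⟩ = α • (A⁻¹ *ᵥ (G l l *ᵥ D.t ⟨l, m⟩)) := by
    rw [hAeq]
    exact hα
  rw [eq_div_iff (hD.noisePower_pos hφ hV _).ne', hn, Streams.gain, hα',
    norm_sq_dotProduct_inv hpd, mul_comm]

theorem covTransform_posSemidef (hD : IsDecomposition φ G V S D) (hφ : ∀ l k, 0 ≤ φ l k)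
    (hV : ∀ l, (V l).PosDef) {Vhat : (l : Fin L) → Matrix (Fin (tx l)) (Fin (tx l)) ℂ}
    (hVhat : ∀ l, (Vhat l).PosSemidef) (l : Fin L) :
    (D.covTransform φ G V Vhat l).PosSemidef :=
  sum_streams_posSemidef (hD.powerMatrix_mulVec_nonneg hφ hV fun s => quadForm_nonneg (hVhat s.1) _)
    _ l

/-- The covariance transformation does not decrease any rate. -/
theorem rate_le_rate_covTransform (hD : IsDecomposition φ G V S D) (hφ : ∀ l k, 0 ≤ φ l k)
    (hφ0 : ∀ l, φ l l = 0) (hV : ∀ l, (V l).PosDef)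
    {Vhat : (l : Fin L) → Matrix (Fin (tx l)) (Fin (tx l)) ℂ}
    (hVhat : ∀ l, (Vhat l).PosDef) (l : Fin L) :
    rate φ G V S l ≤ rate φᵀ (fun l k => (G k l)ᴴ) Vhat (D.covTransform φ G V Vhat) l := by
  set q := D.powerMatrix φ G V *ᵥ fun s => quadForm (Vhat s.1) (D.t s) with hq
  set S' := D.covTransform φ G V Vhat with hS'
  have hS'eq : ∀ l, S' l = ∑ m : Fin (D.M l), q ⟨l, m⟩ • rankOne (D.r ⟨l, m⟩) := fun l => rfl
  have hqpos : ∀ s, 0 < q s := hD.powerMatrix_mulVec_pos hφ hV fun s =>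
    quadForm_pos (hVhat s.1) (ne_zero_of_unit (hD.t_unit s))
  have hφT : ∀ l k, 0 ≤ φᵀ l k := fun l k => hφ k l
  have hpsd := hD.covTransform_posSemidef hφ hV fun l => (hVhat l).posSemidef
  have hS : sandwich (G l l)ᴴ (S' l) = ∑ m, q ⟨l, m⟩ • rankOne ((G l l)ᴴ *ᵥ D.r ⟨l, m⟩) := by
    rw [hS'eq l, sandwich_sum]
    exact Finset.sum_congr rfl fun m _ => by rw [sandwich_smul, sandwich_rankOne]
  have h := log_det_one_add (omega_posDef (G := fun l k => (G k l)ᴴ) hφT hVhat hpsd l)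
    (fun m => q ⟨l, m⟩) (fun m => (hqpos _).le) (fun m => (G l l)ᴴ *ᵥ D.r ⟨l, m⟩)
  rw [hD.rate_eq_sum_sinr hφ hφ0 hV, rate]
  rw [hS, h]
  refine Finset.sum_le_sum fun m _ => ?_
  have hgain : ∀ k n, ‖star (D.t ⟨l, m⟩) ⬝ᵥ ((G k l)ᴴ *ᵥ D.r ⟨k, n⟩)‖ ^ 2
      = D.gain G ⟨k, n⟩ ⟨l, m⟩ := fun k n => by
    rw [Streams.gain, norm_star_dotProduct_comm, star_mulVec, conjTranspose_conjTranspose,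
      ← dotProduct_mulVec]
  have hpd := interference_posDef (G := fun l k => (G k l)ᴴ) hφT hVhat hpsd (M := D.M) (p := q)
    (fun s => (hqpos s).le) D.r l {i | i < m}
  have hquad := quadForm_interference (φ := φᵀ) (G := fun l k => (G k l)ᴴ) (V := Vhat) hS'eq l
    {i | i < m} (D.t ⟨l, m⟩)
  simp only [hgain, transpose_apply] at hquad
  have hkey := hD.noisePower_mul_powerMatrix_mulVec hφ hV
    (fun s => quadForm (Vhat s.1) (D.t s)) ⟨l, m⟩
  rw [Streams.crosstalk_transpose_mulVec hφ0, ← hq, ← hquad] at hkey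
  -- As a dual receive vector `t` need not be MMSE; Cauchy–Schwarz bounds its SINR by the optimal
  -- one, which is what the dual rate counts.
  have hcs := norm_sq_dotProduct_le hpd (D.t ⟨l, m⟩) ((G l l)ᴴ *ᵥ D.r ⟨l, m⟩)
  rw [hgain, ← hkey] at hcs
  simp only [sandwich_rankOne] at hcs
  rw [add_comm] at hcs
  have hn := hD.noisePower_pos hφ hV ⟨l, m⟩
  have hp := hD.p_pos ⟨l, m⟩
  refine Real.log_le_log (by linarith [hD.sinr_nonneg hφ hV ⟨l, m⟩]) (add_le_add_right ?_ 1)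
  rw [Streams.sinr, div_le_iff₀ hn]
  have h1 := mul_le_mul_of_nonneg_left hcs hp.le
  refine h1.trans (le_of_eq ?_)
  field_simp

theorem sum_trace_mul (hD : IsDecomposition φ G V S D)
    (X : (l : Fin L) → Matrix (Fin (tx l)) (Fin (tx l)) ℂ) :
    (∑ l, (S l * X l).trace).re = D.p ⬝ᵥ fun s => quadForm (X s.1) (D.t s) := by
  rw [dotProduct, Fintype.sum_sigma, Complex.re_sum]
  refine Finset.sum_congr rfl fun l _ => ?_
  rw [hD.sum_eq l]
  exact trace_sum_rankOne_mul _ _ _ _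

end IsDecomposition

theorem Streams.sum_trace_covTransform_mul (D : Streams L tx rx)
    (Vhat : (l : Fin L) → Matrix (Fin (tx l)) (Fin (tx l)) ℂ)
    (X : (l : Fin L) → Matrix (Fin (rx l)) (Fin (rx l)) ℂ) :
    (∑ l, (D.covTransform φ G V Vhat l * X l).trace).re = (fun s => quadForm (X s.1) (D.r s)) ⬝ᵥ
      (D.powerMatrix φ G V *ᵥ fun s => quadForm (Vhat s.1) (D.t s)) := by
  rw [dotProduct, Fintype.sum_sigma, Complex.re_sum]
  refine Finset.sum_congr rfl fun l _ => ?_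
  exact (trace_sum_rankOne_mul _ _ _ _).trans (Finset.sum_congr rfl fun m _ => mul_comm _ _)

/-! ### Matching the cost of every hop -/

/-- Data of the hops of a network: noise covariances `Vf`, weight matrices `Vr` and the costs `b` of
the noise of hop `i` at the later hop `j`. -/
noncomputable def hopMatrix (φ : Matrix (Fin L) (Fin L) ℝ)
    (G : (l k : Fin L) → Matrix (Fin (rx l)) (Fin (tx k)) ℂ) (D : Streams L tx rx) {n : ℕ}
    (Vf : Fin (n + 1) → (l : Fin L) → Matrix (Fin (rx l)) (Fin (rx l)) ℂ)
    (Vr : Fin (n + 1) → (l : Fin L) → Matrix (Fin (tx l)) (Fin (tx l)) ℂ)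
    (b : Fin (n + 1) → Fin (n + 1) → ℝ) (P : Fin (n + 1) → ℝ) :
    Matrix (Fin (n + 1)) (Fin (n + 1)) ℝ :=
  fun i j => ((fun s => quadForm (Vf i s.1) (D.r s)) ⬝ᵥ
    (D.powerMatrix φ G (fun l => ∑ i, Vf i l) *ᵥ fun s => quadForm (Vr j s.1) (D.t s))
      + if i < j then b i j else 0) / P i

variable {n : ℕ} {Vf : Fin (n + 1) → (l : Fin L) → Matrix (Fin (rx l)) (Fin (rx l)) ℂ}
  {Vr : Fin (n + 1) → (l : Fin L) → Matrix (Fin (tx l)) (Fin (tx l)) ℂ}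
  {b : Fin (n + 1) → Fin (n + 1) → ℝ} {P : Fin (n + 1) → ℝ}

theorem sum_smul_posDef {ι m : Type*} [Fintype ι] [Fintype m] {X : ι → Matrix m m ℂ}
    (hX : ∀ i, (X i).PosSemidef) {d : ι → ℝ} (hd : ∀ i, 0 < d i) {i₀ : ι} (h0 : (X i₀).PosDef) :
    (∑ i, d i • X i).PosDef := by
  classical
  rw [← Finset.add_sum_erase _ _ (Finset.mem_univ i₀)]
  exact (smul_posDef h0 (hd i₀)).add_posSemidef
    (posSemidef_sum _ fun i _ => smul_posSemidef (hX i) (hd i).le)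

theorem sum_posDef {ι m : Type*} [Fintype ι] [Fintype m] {X : ι → Matrix m m ℂ}
    (hX : ∀ i, (X i).PosSemidef) {i₀ : ι} (h0 : (X i₀).PosDef) : (∑ i, X i).PosDef := by
  simpa using sum_smul_posDef hX (d := fun _ => 1) (fun _ => one_pos) h0

/-- Hop `0` is paid for by a nonzero input; every later hop is paid for already by the noise `b`
from the hop just before it. -/
theorem cost_pos (hS : ∀ l, (S l).PosSemidef) (hS0 : ∃ l, S l ≠ 0)
    (hVr : ∀ i l, (Vr i l).PosSemidef) (hVr0 : ∀ l, (Vr 0 l).PosDef)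
    (hb : ∀ i j, i < j → 0 ≤ b i j) (hbs : ∀ i : Fin n, 0 < b i.castSucc i.succ)
    (i : Fin (n + 1)) :
    0 < (∑ l, (S l * Vr i l).trace).re + ∑ k, if k < i then b k i else 0 := by
  have h1 : ∀ i, 0 ≤ (∑ l, (S l * Vr i l).trace).re := fun i => by
    rw [Complex.re_sum]
    exact Finset.sum_nonneg fun l _ => trace_mul_re_nonneg (hS l) (hVr i l)
  have h2 : ∀ i, ∀ k ∈ Finset.univ, 0 ≤ if k < i then b k i else 0 := fun i k _ => by
    split_ifs with h
    · exact hb _ _ h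
    · exact le_rfl
  induction i using Fin.cases with
  | zero =>
    refine add_pos_of_pos_of_nonneg ?_ (Finset.sum_nonneg (h2 0))
    obtain ⟨l, hl⟩ := hS0
    rw [Complex.re_sum]
    exact Finset.sum_pos' (fun l _ => trace_mul_re_nonneg (hS l) (hVr 0 l))
      ⟨l, Finset.mem_univ l, trace_mul_re_pos (hS l) hl (hVr0 l)⟩
  | succ i =>
    refine add_pos_of_nonneg_of_pos (h1 _) (Finset.sum_pos' (h2 _) ⟨i.castSucc, Finset.mem_univ _, ?_⟩)
    rw [if_pos (Fin.castSucc_lt_succ)]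
    exact hbs i

/-- The dominant eigenvector of the hop matrix scales the weight matrices so that the covariance
transformation reproduces the cost of every hop. -/
theorem IsDecomposition.exists_scaling
    (hD : IsDecomposition φ G (fun l => ∑ i, Vf i l) S D) (hφ : ∀ l k, 0 ≤ φ l k)
    (hφ0 : ∀ l, φ l l = 0) (hS0 : ∃ l, S l ≠ 0)
    (hVf : ∀ i l, (Vf i l).PosSemidef) (hVfn : ∀ l, (Vf (Fin.last n) l).PosDef)
    (hVr : ∀ i l, (Vr i l).PosSemidef) (hVr0 : ∀ l, (Vr 0 l).PosDef)
    (hb : ∀ i j, i < j → 0 ≤ b i j) (hbs : ∀ i : Fin n, 0 < b i.castSucc i.succ)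
    (hP : ∀ i, P i = (∑ l, (S l * Vr i l).trace).re + ∑ k, if k < i then b k i else 0) :
    ∃ d, RelayNetwork.IsDominantEigenvector (hopMatrix φ G D Vf Vr b P) d ∧
      (∀ d', RelayNetwork.IsDominantEigenvector (hopMatrix φ G D Vf Vr b P) d' → d' = d) ∧
      (∀ i, 0 < d i) ∧
      (∀ l, (D.covTransform φ G (fun l => ∑ i, Vf i l)
        (fun l => ∑ j, d j • Vr j l) l).PosSemidef) ∧
      (∀ l, rate φ G (fun l => ∑ i, Vf i l) S l ≤
        rate φᵀ (fun l k => (G k l)ᴴ) (fun l => ∑ j, d j • Vr j l)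
          (D.covTransform φ G (fun l => ∑ i, Vf i l) (fun l => ∑ j, d j • Vr j l)) l) ∧
      ∀ i, (∑ l, (D.covTransform φ G (fun l => ∑ i, Vf i l) (fun l => ∑ j, d j • Vr j l) l
        * Vf i l).trace).re + (∑ j, if i < j then d j * b i j else 0) = d i * P i := by
  have hV : ∀ l, (∑ i, Vf i l).PosDef := fun l => sum_posDef (fun i => hVf i l) (hVfn l)
  have hPpos : ∀ i, 0 < P i := fun i => by
    rw [hP i]; exact cost_pos hD.posSemidef hS0 hVr hVr0 hb hbs i
  have hf : ∀ i s, 0 ≤ quadForm (Vf i s.1) (D.r s) := fun i s => quadForm_nonneg (hVf i s.1) _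
  have hr : ∀ i s, 0 ≤ quadForm (Vr i s.1) (D.t s) := fun i s => quadForm_nonneg (hVr i s.1) _
  have ha : ∀ i j, 0 ≤ (fun s => quadForm (Vf i s.1) (D.r s)) ⬝ᵥ
      (D.powerMatrix φ G (fun l => ∑ i, Vf i l) *ᵥ fun s => quadForm (Vr j s.1) (D.t s)) :=
    fun i j => Finset.sum_nonneg fun s _ => mul_nonneg (hf i s)
      (hD.powerMatrix_mulVec_nonneg hφ hV (hr j) s)
  have hb' : ∀ i j, 0 ≤ if i < j then b i j else 0 := fun i j => by
    split_ifs with h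
    · exact hb _ _ h
    · exact le_rfl
  have hA : ∀ i j, 0 ≤ hopMatrix φ G D Vf Vr b P i j := fun i j =>
    div_nonneg (add_nonneg (ha i j) (hb' i j)) (hPpos i).le
  have hlast : 0 < hopMatrix φ G D Vf Vr b P (Fin.last n) 0 := by
    refine div_pos (add_pos_of_pos_of_nonneg ?_ (hb' _ _)) (hPpos _)
    obtain ⟨l, hl⟩ := hS0
    obtain ⟨m⟩ : Nonempty (Fin (D.M l)) := by
      by_contra hne
      rw [not_nonempty_iff] at hne
      exact hl (by rw [hD.sum_eq l]; simp)
    have hpos : ∀ s, 0 < quadForm (Vf (Fin.last n) s.1) (D.r s) * (D.powerMatrix φ G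
        (fun l => ∑ i, Vf i l) *ᵥ fun s => quadForm (Vr 0 s.1) (D.t s)) s := fun s =>
      mul_pos (quadForm_pos (hVfn s.1) (ne_zero_of_unit (hD.r_unit s)))
        (hD.powerMatrix_mulVec_pos hφ hV (fun s => quadForm_pos (hVr0 s.1)
          (ne_zero_of_unit (hD.t_unit s))) s)
    exact Finset.sum_pos' (fun s _ => (hpos s).le) ⟨⟨l, m⟩, Finset.mem_univ _, hpos _⟩
  have hsucc : ∀ i : Fin n, 0 < hopMatrix φ G D Vf Vr b P i.castSucc i.succ := fun i => by
    refine div_pos (add_pos_of_nonneg_of_pos (ha _ _) ?_) (hPpos _)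
    rw [if_pos (Fin.castSucc_lt_succ)]
    exact hbs i
  have hmul : ∀ i j, P i * hopMatrix φ G D Vf Vr b P i j =
      (fun s => quadForm (Vf i s.1) (D.r s)) ⬝ᵥ
      (D.powerMatrix φ G (fun l => ∑ i, Vf i l) *ᵥ fun s => quadForm (Vr j s.1) (D.t s))
      + if i < j then b i j else 0 := fun i j => mul_div_cancel₀ _ (hPpos i).ne'
  -- The division by `P i` in row `i` is undone by the weight `P i`. The `a` part of column `j` then
  -- sums to `p · n̂_j` and the `b` part to the forwarded noise, together the cost of hop `j`.
  have hPA : P ᵥ* hopMatrix φ G D Vf Vr b P = P := by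
    ext j
    rw [vecMul, dotProduct]
    simp only [hmul]
    rw [Finset.sum_add_distrib, hP j, hD.sum_trace_mul,
      ← hD.noise_dotProduct_powerMatrix hφ hV, ← sum_dotProduct]
    congr 2
    ext s
    rw [quadForm_sum, Finset.sum_apply]
  obtain ⟨d, hd, hdpos, hAd, huniq⟩ := exists_dominantEigenvector hA hlast hsucc hPpos hPA
  refine ⟨d, hd, huniq, hdpos, ?_, ?_, ?_⟩
  · exact hD.covTransform_posSemidef hφ hV fun l =>
      (sum_smul_posDef (fun i => hVr i l) hdpos (hVr0 l)).posSemidef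
  · exact hD.rate_le_rate_covTransform hφ hφ0 hV fun l =>
      sum_smul_posDef (fun i => hVr i l) hdpos (hVr0 l)
  · intro i
    have h1 : (fun s : Σ l : Fin L, Fin (D.M l) => quadForm (∑ j, d j • Vr j s.1) (D.t s))
        = ∑ j, d j • fun s : Σ l : Fin L, Fin (D.M l) => quadForm (Vr j s.1) (D.t s) := by
      ext s
      simp [quadForm_sum, quadForm_smul]
    rw [Streams.sum_trace_covTransform_mul, h1, mulVec_sum, dotProduct_sum]
    simp only [mulVec_smul, dotProduct_smul, smul_eq_mul]
    rw [← Finset.sum_add_distrib]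
    -- The cost equation is row `i` of `A d = d` multiplied by `P i`.
    conv_rhs => rw [← congrFun hAd i, mul_comm, mulVec, dotProduct, Finset.mul_sum]
    refine Finset.sum_congr rfl fun j _ => ?_
    rw [← mul_assoc, hmul, add_mul, ite_mul, zero_mul, mul_comm (d j), mul_comm (d j)]

/-- Existence form of `IsDecomposition.exists_scaling`. -/
theorem exists_dual_covariance (hφ : ∀ l k, 0 ≤ φ l k)
    (hφ0 : ∀ l, φ l l = 0) (hrx : ∀ l, 0 < rx l) (hS : ∀ l, (S l).PosSemidef) (hS0 : ∃ l, S l ≠ 0)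
    (hVf : ∀ i l, (Vf i l).PosSemidef) (hVfn : ∀ l, (Vf (Fin.last n) l).PosDef)
    (hVr : ∀ i l, (Vr i l).PosSemidef) (hVr0 : ∀ l, (Vr 0 l).PosDef)
    (hb : ∀ i j, i < j → 0 ≤ b i j) (hbs : ∀ i : Fin n, 0 < b i.castSucc i.succ)
    (hP : ∀ i, P i = (∑ l, (S l * Vr i l).trace).re + ∑ k, if k < i then b k i else 0) :
    ∃ (d : Fin (n + 1) → ℝ) (S' : (l : Fin L) → Matrix (Fin (rx l)) (Fin (rx l)) ℂ),
      (∀ i, 0 < d i) ∧ d (Fin.last n) = 1 ∧ (∀ l, (S' l).PosSemidef) ∧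
      (∀ l, rate φ G (fun l => ∑ i, Vf i l) S l ≤
        rate φᵀ (fun l k => (G k l)ᴴ) (fun l => ∑ j, d j • Vr j l) S' l) ∧
      ∀ i, (∑ l, (S' l * Vf i l).trace).re + (∑ j, if i < j then d j * b i j else 0)
        = d i * P i := by
  obtain ⟨D, hD⟩ := exists_isDecomposition φ G hφ
    (fun l => sum_posDef (fun i => hVf i l) (hVfn l)) hS hrx
  obtain ⟨d, ⟨_, _, _, hl⟩, _, hpos, hpsd, hrate, hcost⟩ :=
    hD.exists_scaling hφ hφ0 hS0 hVf hVfn hVr hVr0 hb hbs hP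
  exact ⟨d, _, hpos, hl, hpsd, hrate, hcost⟩

/-- Signal, interference and noise powers all acquire the factor `c`, which cancels against the
inverse. -/
theorem rate_smul {c : ℝ} (hc : 0 < c) (hφ : ∀ l k, 0 ≤ φ l k) (hV : ∀ l, (V l).PosDef)
    (hS : ∀ l, (S l).PosSemidef) (l : Fin L) :
    rate φ (fun l k => Real.sqrt c • G l k) (fun l => c • V l) S l = rate φ G V S l := by
  have h1 : omega φ (fun l k => Real.sqrt c • G l k) (fun l => c • V l) S l
      = c • omega φ G V S l := by
    simp only [omega, sqrt_smul_sandwich _ hc.le, smul_add, Finset.smul_sum]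
    congr 1
    exact Finset.sum_congr rfl fun k _ => smul_comm _ _ _
  have h2 : (c • omega φ G V S l)⁻¹ = c⁻¹ • (omega φ G V S l)⁻¹ := by
    apply inv_eq_right_inv
    rw [smul_mul_smul_comm, mul_nonsing_inv _
      ((isUnit_iff_isUnit_det _).1 (omega_posDef hφ hV hS l).isUnit), mul_inv_cancel₀ hc.ne', one_smul]
  rw [rate, rate, h1, h2, sqrt_smul_sandwich _ hc.le, smul_mul_smul_comm, mul_inv_cancel₀ hc.ne',
    one_smul]

theorem rate_eq_zero_of_sandwich_eq_zero (l : Fin L) (h : sandwich (G l l) (S l) = 0) :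
    rate φ G V S l = 0 := by
  simp [rate, h]

end Hops

end IFN

theorem Finset.sum_Icc_one_eq_sum_range {M : Type*} [AddCommMonoid M] (n : ℕ) (f : ℕ → M) :
    ∑ q ∈ Finset.Icc 1 n, f q = ∑ i ∈ Finset.range n, f (i + 1) := by
  induction n with
  | zero => simp
  | succ n ih => rw [Finset.sum_Icc_succ_top (by omega), ih, Finset.sum_range_succ]

theorem Finset.sum_Icc_one_add_zero {M : Type*} [AddCommMonoid M] (n : ℕ) (f : ℕ → M) :
    ∑ q ∈ Finset.Icc 1 n, f q + f 0 = ∑ i : Fin (n + 1), f i := by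
  rw [Fin.sum_univ_eq_sum_range, Finset.sum_range_succ', Finset.sum_Icc_one_eq_sum_range]

/-! ### The relay network and its dual as hop data -/

namespace RelayNetwork

variable (N : RelayNetwork)

theorem B_self (F : N.Precoders) (q : ℕ) : N.B F q q = N.composite F q := by
  simp [B, Nat.leRec_self]

theorem B_succ (F : N.Precoders) {q k : ℕ} (h : q ≤ k) :
    N.B F q (k + 1) = N.composite F (k + 1) * N.H k * N.B F q k := by
  simp only [B, h, h.trans (Nat.le_succ k), dif_pos]
  rw [Nat.leRec_succ _ _ h]

theorem B_eq_zero_of_composite (F : N.Precoders) {k : ℕ} (hk : N.composite F k = 0) {q q' : ℕ}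
    (h1 : q ≤ k) (h2 : k ≤ q') : N.B F q q' = 0 := by
  induction q', h2 using Nat.le_induction with
  | base =>
    obtain rfl | h := h1.eq_or_lt
    · rw [B_self, hk]
    · obtain ⟨k, rfl⟩ : ∃ j, k = j + 1 := ⟨k - 1, by omega⟩
      rw [B_succ _ _ (by omega), hk, Matrix.zero_mul, Matrix.zero_mul]
  | succ q' h ih => rw [B_succ _ _ (h1.trans h), ih, Matrix.mul_zero]

/-- Part of the noise covariance at the destination of link `l` that stems from cluster `i + 1`
(from the destination itself for `i = Q`). -/
noncomputable def fwdHop (F : N.Precoders) (i : ℕ) (l : Fin N.L) :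
    Matrix (Fin (N.rx l)) (Fin (N.rx l)) ℂ :=
  if i = N.Q then N.Wdest l else sandwich (N.HQ l * N.B F (i + 1) N.Q) (N.W (i + 1))

/-- Part of the noise covariance at the destination of dual link `l` that stems from cluster `i`
(from the destination itself for `i = 0`), for precoders that are the adjoints of `F`. -/
noncomputable def revHop (F : N.Precoders) (i : ℕ) (l : Fin N.L) :
    Matrix (Fin (N.tx l)) (Fin (N.tx l)) ℂ :=
  if i = 0 then N.Whatsrc l else sandwich ((N.H0 l)ᴴ * (N.B F 1 i)ᴴ) (N.What i)

/-- Blockwise conjugate transposes of precoders. -/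
def adjointPrecoders (F : N.Precoders) : N.Precoders := fun q j => (F q j)ᴴ

/-- Precoders rescaled so that `B_{q,q'}` is multiplied by `√(e_{q'} / e_{q-1})`. -/
noncomputable def scalePrecoders (e : ℕ → ℝ) (F : N.Precoders) : N.Precoders :=
  fun q j => Real.sqrt (e q / e (q - 1)) • F q j

/-- Cost of the dual network that corresponds to hop `i`, for precoders that are the adjoints of
`F`. -/
noncomputable def dualCost (S : N.DualCov) (F : N.Precoders) (i : ℕ) : ℝ :=
  (∑ l, (S l * N.fwdHop F i l).trace).re
    + ∑ j : Fin (N.Q + 1), if i < (j : ℕ) then N.b F (i + 1) j else 0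

theorem φ_nonneg (l k : Fin N.L) : 0 ≤ N.φ l k := by
  rcases N.φ_binary l k with h | h <;> simp [h]

theorem fwdHop_posSemidef (F : N.Precoders) {i : ℕ} (hi : i ≤ N.Q) (l : Fin N.L) :
    (N.fwdHop F i l).PosSemidef := by
  unfold fwdHop
  split_ifs with h
  · exact (N.Wdest_posDef l).posSemidef
  · exact sandwich_posSemidef _ (N.W_posDef (i + 1) (by omega) (by omega)).posSemidef

theorem revHop_posSemidef (F : N.Precoders) {i : ℕ} (hi : i ≤ N.Q) (l : Fin N.L) :
    (N.revHop F i l).PosSemidef := by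
  unfold revHop
  split_ifs with h
  · exact (N.Whatsrc_posDef l).posSemidef
  · exact sandwich_posSemidef _ (N.What_posDef i (by omega) hi).posSemidef

theorem fwdHop_last (F : N.Precoders) (l : Fin N.L) : N.fwdHop F N.Q l = N.Wdest l := if_pos rfl

theorem revHop_zero (F : N.Precoders) (l : Fin N.L) : N.revHop F 0 l = N.Whatsrc l := if_pos rfl

theorem b_nonneg (F : N.Precoders) {i j : ℕ} (hij : i < j) (hj : j ≤ N.Q) :
    0 ≤ N.b F (i + 1) j :=
  trace_mul_re_nonneg
    (sandwich_posSemidef _ (N.W_posDef (i + 1) (by omega) (by omega)).posSemidef)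
    (N.What_posDef j (by omega) hj).posSemidef

/-- A cluster amplifies at least its own noise: `B_{q,q} = F_q`, and `F W Fᴴ` has the trace of `Fᴴ F
W`, positive for `F ≠ 0`. These are the forward edges of the Perron–Frobenius cycle. -/
theorem b_self_pos (F : N.Precoders) {i : ℕ} (hi : i < N.Q) (hF : N.composite F (i + 1) ≠ 0) :
    0 < N.b F (i + 1) (i + 1) := by
  have hW := N.W_posDef (i + 1) (by omega) (by omega)
  refine trace_mul_re_pos (sandwich_posSemidef _ hW.posSemidef) (fun h0 => ?_)
    (N.What_posDef (i + 1) (by omega) (by omega))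
  rw [B_self] at h0
  have h1 : ((N.composite F (i + 1))ᴴ * N.composite F (i + 1)) ≠ 0 := fun h =>
    hF (conjTranspose_mul_self_eq_zero.1 h)
  have h2 := trace_mul_re_pos (posSemidef_conjTranspose_mul_self (N.composite F (i + 1))) h1 hW
  rw [sandwich] at h0
  rw [Matrix.mul_assoc, trace_mul_comm, h0] at h2
  simp at h2

theorem noise_eq (F : N.Precoders) :
    N.noise F = fun l => ∑ i : Fin (N.Q + 1), N.fwdHop F i l := by
  ext1 l
  rw [noise, Fin.sum_univ_eq_sum_range (fun i => N.fwdHop F i l), Finset.sum_range_succ,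
    fwdHop_last, Finset.sum_Icc_one_eq_sum_range (f := fun q => sandwich (N.HQ l * N.B F q N.Q) (N.W q))]
  congr 1
  exact Finset.sum_congr rfl fun i hi => by
    rw [fwdHop, if_neg (Finset.mem_range.1 hi).ne]

theorem dualB_adjointPrecoders (F : N.Precoders) (q q' : ℕ) :
    N.dualB (N.adjointPrecoders F) q q' = N.B F q q' := by
  simp [dualB, adjointPrecoders]

theorem adjointPrecoders_adjointPrecoders (F : N.Precoders) :
    N.adjointPrecoders (N.adjointPrecoders F) = F := by
  funext q j
  simp [adjointPrecoders]

theorem sum_Icc_revHop (F : N.Precoders) (l : Fin N.L) (c : ℕ → ℝ) :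
    ∑ q ∈ Finset.Icc 1 N.Q, c q • sandwich ((N.H0 l)ᴴ * (N.B F 1 q)ᴴ) (N.What q)
      + c 0 • N.Whatsrc l = ∑ i : Fin (N.Q + 1), c i • N.revHop F i l := by
  rw [← Finset.sum_Icc_one_add_zero N.Q (fun i => c i • N.revHop F i l), revHop_zero]
  congr 1
  exact Finset.sum_congr rfl fun q hq => by
    rw [revHop, if_neg (by have := (Finset.mem_Icc.1 hq).1; omega)]

theorem dualNoise_eq (F : N.Precoders) :
    N.dualNoise (N.adjointPrecoders F) = fun l => ∑ i : Fin (N.Q + 1), N.revHop F i l := by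
  ext1 l
  have h := N.sum_Icc_revHop F l (fun _ => 1)
  simp only [one_smul] at h
  rw [dualNoise, add_comm, ← h]
  simp only [dualB_adjointPrecoders]

theorem dualChannel_eq (F : N.Precoders) :
    N.dualChannel (N.adjointPrecoders F) = fun l k => (N.channel F k l)ᴴ := by
  ext1 l; ext1 k
  simp only [dualChannel, dualB_adjointPrecoders, channel, conjTranspose_mul, Matrix.mul_assoc]

theorem rate_eq (S : N.Cov) (F : N.Precoders) (l : Fin N.L) : N.rate S F l =
    IFN.rate N.φ (N.channel F) (fun l => ∑ i : Fin (N.Q + 1), N.fwdHop F i l) S l := by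
  rw [rate, noise_eq]

theorem dualRate_eq (S : N.DualCov) (F : N.Precoders) (l : Fin N.L) :
    N.dualRate S (N.adjointPrecoders F) l = IFN.rate N.φᵀ (fun l k => (N.channel F k l)ᴴ)
      (fun l => ∑ i : Fin (N.Q + 1), N.revHop F i l) S l := by
  rw [dualRate, dualNoise_eq, dualChannel_eq]

/-- Under the trace, the map from source to cluster can be moved onto the weight matrix, which
becomes a dual noise covariance. The primal weights and the dual noises are thus the same data. -/
theorem txCost_eq (S : N.Cov) (F : N.Precoders) {q : ℕ} (hq : q ≤ N.Q) :
    N.txCost S F q = (∑ l, (S l * N.revHop F q l).trace).re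
      + ∑ k : Fin (N.Q + 1), if (k : ℕ) < q then N.b F (k + 1) q else 0 := by
  have h2 : (∑ k : Fin (N.Q + 1), if (k : ℕ) < q then N.b F (k + 1) q else 0)
      = ∑ q' ∈ Finset.Icc 1 q, N.b F q' q := by
    rw [Fin.sum_univ_eq_sum_range (fun k => if k < q then N.b F (k + 1) q else 0),
      Finset.sum_Icc_one_eq_sum_range, ← Finset.sum_filter]
    refine Finset.sum_congr ?_ fun _ _ => rfl
    ext k
    simp only [Finset.mem_filter, Finset.mem_range]
    omega
  rw [h2, txCost]
  split_ifs with h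
  · subst h
    simp [revHop_zero]
  · rw [relayCov, Matrix.add_mul, trace_add, Complex.add_re, Matrix.sum_mul, Matrix.sum_mul,
      trace_sum, trace_sum, Complex.re_sum (s := Finset.Icc 1 q)]
    congr 2
    refine Finset.sum_congr rfl fun l _ => ?_
    rw [trace_sandwich_mul, conjTranspose_mul, revHop, if_neg h]

/-- Hop `Q` is the first dual hop: no `j > Q` contributes forwarded noise, so `F` is arbitrary. -/
theorem dualSourceCost_eq (S : N.DualCov) (F : N.Precoders) :
    N.dualSourceCost S = N.dualCost S F N.Q := by
  rw [dualSourceCost, dualCost, Finset.sum_eq_zero (fun j _ => if_neg (by omega)), add_zero]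
  simp only [fwdHop_last]

/-- Cluster `i + 1` transmits over hop `i` in the dual network. Its forwarded noise costs the same
numbers `b`, by the adjunction of the trace. -/
theorem dualRelayCost_eq (S : N.DualCov) (F : N.Precoders) {i : ℕ} (hi : i < N.Q) :
    N.dualRelayCost S (N.adjointPrecoders F) (i + 1) = N.dualCost S F i := by
  have h2 : (∑ j : Fin (N.Q + 1), if i < (j : ℕ) then N.b F (i + 1) j else 0)
      = ∑ q' ∈ Finset.Icc (i + 1) N.Q, N.b F (i + 1) q' := by
    rw [Fin.sum_univ_eq_sum_range (fun k => if i < k then N.b F (i + 1) k else 0),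
      ← Finset.sum_filter]
    refine Finset.sum_congr ?_ fun _ _ => rfl
    ext k
    simp only [Finset.mem_filter, Finset.mem_range, Finset.mem_Icc]
    omega
  rw [dualRelayCost, dualCost, h2, dualRelayCov, Matrix.add_mul, trace_add, Complex.add_re,
    Matrix.sum_mul, Matrix.sum_mul, trace_sum, trace_sum, Complex.re_sum (s := Finset.Icc (i + 1) N.Q)]
  simp only [dualB_adjointPrecoders]
  congr 1
  · congr 1
    refine Finset.sum_congr rfl fun l _ => ?_
    rw [trace_sandwich_mul, conjTranspose_mul, conjTranspose_conjTranspose,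
      conjTranspose_conjTranspose, fwdHop, if_neg hi.ne]
  · refine Finset.sum_congr rfl fun q _ => ?_
    rw [b, trace_sandwich_mul, trace_mul_comm, conjTranspose_conjTranspose]

theorem dualPerHop_iff (P : ℕ → ℝ) (S : N.DualCov) (F : N.Precoders) :
    N.DualPerHop P S (N.adjointPrecoders F) ↔ ∀ i, i ≤ N.Q → N.dualCost S F i ≤ P i := by
  rw [DualPerHop, N.dualSourceCost_eq S F]
  constructor
  · rintro ⟨h1, h2⟩ i hi
    obtain rfl | h := hi.eq_or_lt
    · exact h1
    · rw [← N.dualRelayCost_eq S F h]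
      exact h2 (i + 1) (by omega) (by omega)
  · intro h
    refine ⟨h _ le_rfl, fun q h1 h2 => ?_⟩
    obtain ⟨i, rfl⟩ : ∃ i, q = i + 1 := ⟨q - 1, by omega⟩
    rw [N.dualRelayCost_eq S F (by omega)]
    exact h i (by omega)

/-! ### Rescaling the precoders -/

section Scaling

variable {e : ℕ → ℝ} (he : ∀ i, i ≤ N.Q → 0 < e i) (F : N.Precoders)

theorem composite_scalePrecoders (e : ℕ → ℝ) (q : ℕ) : N.composite (N.scalePrecoders e F) q
    = Real.sqrt (e q / e (q - 1)) • N.composite F q :=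
  blockDiagonal'_smul (Real.sqrt (e q / e (q - 1))) (F q)

include he in
-- The factors `√(e q / e (q - 1))` for `q = i + 1, …, j` telescope.
theorem B_scalePrecoders {i j : ℕ} (hij : i < j) (hj : j ≤ N.Q) :
    N.B (N.scalePrecoders e F) (i + 1) j = Real.sqrt (e j / e i) • N.B F (i + 1) j := by
  induction j, hij using Nat.le_induction with
  | base => rw [B_self, B_self, composite_scalePrecoders, Nat.add_sub_cancel]
  | succ j h ih =>
    rw [B_succ _ _ h, B_succ _ _ h, ih (by omega), composite_scalePrecoders, Nat.add_sub_cancel,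
      Matrix.smul_mul, Matrix.smul_mul, Matrix.mul_smul, smul_smul]
    have h0 := he i (by omega)
    have h1 := he j (by omega)
    have h2 := he (j + 1) hj
    rw [← Real.sqrt_mul (by positivity)]
    congr 2
    field_simp

include he in
theorem fwdHop_scalePrecoders {i : ℕ} (hi : i ≤ N.Q) (l : Fin N.L) :
    N.fwdHop (N.scalePrecoders e F) i l = (e N.Q / e i) • N.fwdHop F i l := by
  have h0 := he i hi
  have h1 := he N.Q le_rfl
  unfold fwdHop
  split_ifs with h
  · rw [h, div_self h1.ne', one_smul]
  · rw [N.B_scalePrecoders he F (by omega) le_rfl, Matrix.mul_smul,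
      sqrt_smul_sandwich _ (by positivity)]

include he in
theorem revHop_scalePrecoders {i : ℕ} (hi : i ≤ N.Q) (l : Fin N.L) :
    N.revHop (N.scalePrecoders e F) i l = (e i / e 0) • N.revHop F i l := by
  have h0 := he i hi
  have h1 := he 0 (Nat.zero_le _)
  unfold revHop
  split_ifs with h
  · rw [h, div_self h1.ne', one_smul]
  · rw [N.B_scalePrecoders he F (i := 0) (by omega) hi, conjTranspose_smul, star_trivial,
      Matrix.mul_smul, sqrt_smul_sandwich _ (by positivity)]

include he in
theorem b_scalePrecoders {i j : ℕ} (hij : i < j) (hj : j ≤ N.Q) :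
    N.b (N.scalePrecoders e F) (i + 1) j = e j / e i * N.b F (i + 1) j := by
  have h0 := he i (by omega)
  have h1 := he j hj
  rw [b, N.B_scalePrecoders he F hij hj, sqrt_smul_sandwich _ (by positivity), Matrix.smul_mul,
    trace_smul, Complex.smul_re, smul_eq_mul, b]

include he in
theorem channel_scalePrecoders (l k : Fin N.L) :
    N.channel (N.scalePrecoders e F) l k = Real.sqrt (e N.Q / e 0) • N.channel F l k := by
  rw [channel, N.B_scalePrecoders he F (i := 0) N.Q_pos le_rfl, channel, Matrix.mul_smul,
    Matrix.smul_mul]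

include he in
theorem dualCost_scalePrecoders (S : N.DualCov) {i : ℕ} (hi : i ≤ N.Q) :
    e i * N.dualCost S (N.scalePrecoders e F) i
      = e N.Q * (∑ l, (S l * N.fwdHop F i l).trace).re
        + ∑ j : Fin (N.Q + 1), if i < (j : ℕ) then e j * N.b F (i + 1) j else 0 := by
  have h0 := (he i hi).ne'
  rw [dualCost, mul_add, Finset.mul_sum]
  congr 1
  · simp only [N.fwdHop_scalePrecoders he F hi, Matrix.mul_smul, trace_smul, ← Finset.smul_sum,
      Complex.smul_re, smul_eq_mul]
    field_simp
  · refine Finset.sum_congr rfl fun j _ => ?_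
    split_ifs with h
    · rw [N.b_scalePrecoders he F h (by omega)]
      field_simp
    · rw [mul_zero]

include he in
theorem txCost_scalePrecoders (S : N.Cov) {i : ℕ} (hi : i ≤ N.Q) :
    N.txCost S (N.scalePrecoders e F) i
      = e i * ((e 0)⁻¹ * (∑ l, (S l * N.revHop F i l).trace).re
        + ∑ k : Fin (N.Q + 1), if (k : ℕ) < i then (e k)⁻¹ * N.b F (k + 1) i else 0) := by
  rw [N.txCost_eq _ _ hi, mul_add, Finset.mul_sum]
  congr 1
  · simp only [N.revHop_scalePrecoders he F hi, Matrix.mul_smul, trace_smul, ← Finset.smul_sum,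
      Complex.smul_re, smul_eq_mul]
    ring
  · refine Finset.sum_congr rfl fun j _ => ?_
    split_ifs with h
    · rw [N.b_scalePrecoders he F h hi]
      ring
    · rw [mul_zero]

include he in
-- Since `e Q = 1`, the channels carry `√(1 / e 0)` and the noise of hop `i` carries `e i / e 0`;
-- the common `1 / e 0` drops out and leaves the noise weighted by `e`.
theorem dualRate_scalePrecoders (heQ : e N.Q = 1) {S : N.DualCov} (hS : ∀ l, (S l).PosSemidef)
    (l : Fin N.L) : N.dualRate S (N.adjointPrecoders (N.scalePrecoders e F)) l
      = IFN.rate N.φᵀ (fun l k => (N.channel F k l)ᴴ)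
        (fun l => ∑ i : Fin (N.Q + 1), e i • N.revHop F i l) S l := by
  have h0 := he 0 (Nat.zero_le _)
  rw [dualRate_eq, ← IFN.rate_smul (φ := N.φᵀ) (inv_pos.2 h0) (fun l k => N.φ_nonneg k l)
    (fun l => IFN.sum_smul_posDef (fun i : Fin (N.Q + 1) => N.revHop_posSemidef F (by omega) l)
      (fun i => he i (by omega)) (i₀ := 0)
      (by rw [Fin.val_zero, revHop_zero]; exact N.Whatsrc_posDef l)) hS]
  congr 1
  · funext l k
    rw [N.channel_scalePrecoders he F, conjTranspose_smul, star_trivial, heQ, one_div]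
  · funext l
    rw [Finset.smul_sum]
    refine Finset.sum_congr rfl fun i _ => ?_
    rw [N.revHop_scalePrecoders he F (by omega), smul_smul, div_eq_inv_mul]

include he in
theorem rate_scalePrecoders (he0 : e 0 = 1) {S : N.Cov} (hS : ∀ l, (S l).PosSemidef)
    (l : Fin N.L) : N.rate S (N.scalePrecoders e F) l
      = IFN.rate N.φ (N.channel F) (fun l => ∑ i : Fin (N.Q + 1), (e i)⁻¹ • N.fwdHop F i l) S l := by
  have h0 := he N.Q le_rfl
  rw [rate_eq, ← IFN.rate_smul h0 N.φ_nonneg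
    (fun l => IFN.sum_smul_posDef (fun i : Fin (N.Q + 1) => N.fwdHop_posSemidef F (by omega) l)
      (fun i => inv_pos.2 (he i (by omega))) (i₀ := Fin.last N.Q)
      (by rw [Fin.val_last, fwdHop_last]; exact N.Wdest_posDef l)) hS]
  congr 1
  · funext l k
    rw [N.channel_scalePrecoders he F, he0, div_one]
  · funext l
    rw [Finset.smul_sum]
    refine Finset.sum_congr rfl fun i _ => ?_
    rw [N.fwdHop_scalePrecoders he F (by omega), smul_smul, div_eq_mul_inv]

end Scaling

end RelayNetwork

/-! ### The Type II transformation and its converse -/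

namespace RelayNetwork

variable (N : RelayNetwork)

theorem scalingMatrix_eq (S : N.Cov) (F : N.Precoders) (D : IFN.Streams N.L N.tx N.rx) :
    N.scalingMatrix S F D = IFN.hopMatrix N.φ (N.channel F) D
      (fun i : Fin (N.Q + 1) => N.fwdHop F i) (fun i : Fin (N.Q + 1) => N.revHop F i)
      (fun i j => N.b F (i + 1) j) (fun i => N.txCost S F i) := by
  have h1 : ∀ i, N.fwdNoise F D i = fun s => quadForm (N.fwdHop F i s.1) (D.r s) := fun i => by
    funext s
    unfold fwdNoise fwdHop
    split_ifs <;> rfl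
  have h2 : ∀ i, N.revNoise F D i = fun s => quadForm (N.revHop F i s.1) (D.t s) := fun i => by
    funext s
    unfold revNoise revHop
    split_ifs <;> rfl
  funext i j
  rw [scalingMatrix, a, h1, h2, noise_eq]
  rfl

/-- A scaling vector as a function of the hop number. -/
def hopScale {n : ℕ} (d : Fin (n + 1) → ℝ) (i : ℕ) : ℝ := d (Fin.ofNat (n + 1) i)

theorem hopScale_val {n : ℕ} (d : Fin (n + 1) → ℝ) (i : Fin (n + 1)) : hopScale d i = d i := by
  simp [hopScale]

theorem hopScale_last {n : ℕ} (d : Fin (n + 1) → ℝ) : hopScale d n = d (Fin.last n) := by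
  simpa using hopScale_val d (Fin.last n)

theorem hopScale_pos {n : ℕ} {d : Fin (n + 1) → ℝ} (hd : ∀ i, 0 < d i) (i : ℕ) :
    0 < hopScale d i := hd _

/-- The shift by one in `entry` makes `d̃_{q+1}` the weight of hop `q`, so the ratios agree by
definition. -/
theorem typeIIPrecoders_eq (F : N.Precoders) (d : Fin (N.Q + 1) → ℝ) :
    N.typeIIPrecoders F d = N.adjointPrecoders (N.scalePrecoders (hopScale d) F) := by
  funext q j
  simp only [adjointPrecoders, scalePrecoders, conjTranspose_smul, star_trivial]
  rfl

theorem typeIICov_eq (F : N.Precoders) (D : IFN.Streams N.L N.tx N.rx) (d : Fin (N.Q + 1) → ℝ) :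
    N.typeIICov F D d = D.covTransform N.φ (N.channel F)
      (fun l => ∑ i : Fin (N.Q + 1), N.fwdHop F i l)
      (fun l => ∑ j : Fin (N.Q + 1), d j • N.revHop F j l) := by
  have h : N.scaledDualNoise F d = fun l => ∑ j : Fin (N.Q + 1), d j • N.revHop F j l := by
    funext l
    have h1 := N.sum_Icc_revHop F l (hopScale d)
    simp only [hopScale_val] at h1
    rw [← h1, scaledDualNoise]
    simp only [sandwich_smul]
    rfl
  rw [typeIICov, h, noise_eq]

theorem sum_fwdHop_posDef (F : N.Precoders) (l : Fin N.L) :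
    (∑ i : Fin (N.Q + 1), N.fwdHop F i l).PosDef :=
  IFN.sum_posDef (fun i => N.fwdHop_posSemidef F (by omega) l) (i₀ := Fin.last N.Q)
    (by rw [Fin.val_last, fwdHop_last]; exact N.Wdest_posDef l)

theorem exists_isStreamDecomposition {S : N.Cov} (F : N.Precoders) (hS : ∀ l, (S l).PosSemidef) :
    ∃ D, N.IsStreamDecomposition S F D := by
  unfold IsStreamDecomposition
  rw [noise_eq]
  exact IFN.exists_isDecomposition _ _ N.φ_nonneg (N.sum_fwdHop_posDef F) hS N.rx_pos

/-- Rescaling turns `d i` times the dual cost into the left side of the eigenvector equation; `d i >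
0` cancels. -/
theorem dualCost_typeII (F : N.Precoders) {d : Fin (N.Q + 1) → ℝ} (hd : ∀ i, 0 < d i)
    (hl : d (Fin.last N.Q) = 1) {S : N.Cov} {S' : N.DualCov}
    (h : ∀ i : Fin (N.Q + 1), (∑ l, (S' l * N.fwdHop F i l).trace).re
      + (∑ j : Fin (N.Q + 1), if i < j then d j * N.b F (i + 1) j else 0) = d i * N.txCost S F i)
    {i : ℕ} (hi : i ≤ N.Q) :
    N.dualCost S' (N.scalePrecoders (hopScale d) F) i = N.txCost S F i := by
  have h1 := N.dualCost_scalePrecoders (fun i _ => hopScale_pos hd i) F S' hi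
  rw [hopScale_last, hl, one_mul] at h1
  have h2 := h ⟨i, by omega⟩
  simp only [hopScale_val] at h1
  rw [← hopScale_val d] at h2
  exact mul_left_cancel₀ (hopScale_pos hd i).ne' (h1.trans h2)

theorem typeII_duality {S : N.Cov} {F : N.Precoders} (hS0 : ∃ l, S l ≠ 0)
    (hF : ∀ q, 1 ≤ q → q ≤ N.Q → N.composite F q ≠ 0) {D : IFN.Streams N.L N.tx N.rx}
    (hD : N.IsStreamDecomposition S F D) :
    ∃ d, IsDominantEigenvector (N.scalingMatrix S F D) d ∧
      (∀ d', IsDominantEigenvector (N.scalingMatrix S F D) d' → d' = d) ∧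
      (∀ i, 0 < d i) ∧
      (∀ l, (N.typeIICov F D d l).PosSemidef) ∧
      (∀ l, N.rate S F l ≤ N.dualRate (N.typeIICov F D d) (N.typeIIPrecoders F d) l) ∧
      ∀ i, i ≤ N.Q → N.dualCost (N.typeIICov F D d) (N.scalePrecoders (hopScale d) F) i
        = N.txCost S F i := by
  unfold IsStreamDecomposition at hD
  rw [noise_eq] at hD
  have key := hD.exists_scaling (Vf := fun i : Fin (N.Q + 1) => N.fwdHop F i)
    (Vr := fun i : Fin (N.Q + 1) => N.revHop F i) (b := fun i j => N.b F (i + 1) j)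
    (P := fun i => N.txCost S F i) N.φ_nonneg N.φ_diag hS0
    (fun i l => N.fwdHop_posSemidef F (by omega) l)
    (fun l => by rw [Fin.val_last, fwdHop_last]; exact N.Wdest_posDef l)
    (fun i l => N.revHop_posSemidef F (by omega) l)
    (fun l => by rw [Fin.val_zero, revHop_zero]; exact N.Whatsrc_posDef l)
    (fun i j h => N.b_nonneg F h (by omega))
    (fun i => N.b_self_pos F i.2 (hF (i + 1) (by omega) (by omega)))
    (fun i => N.txCost_eq S F (by omega))
  obtain ⟨d, hd, huniq, hpos, hpsd, hrate, hcost⟩ := key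
  rw [scalingMatrix_eq]
  refine ⟨d, hd, huniq, hpos, ?_, ?_, ?_⟩
  · rw [typeIICov_eq]; exact hpsd
  · intro l
    rw [rate_eq, typeIIPrecoders_eq, N.dualRate_scalePrecoders (fun i _ => hopScale_pos hpos i) F
      (by rw [hopScale_last]; exact hd.choose_spec.2.2) (by rw [typeIICov_eq]; exact hpsd), typeIICov_eq]
    simp only [hopScale_val]
    exact hrate l
  · intro i hi
    refine N.dualCost_typeII F hpos hd.choose_spec.2.2 ?_ hi
    rw [typeIICov_eq]
    exact hcost

/-- The converse direction: covariances of the dual network whose precoders are the adjoints of `F`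
are matched by covariances of the network itself. -/
theorem exists_cov_of_dual {S' : N.DualCov} {F : N.Precoders} (hS' : ∀ l, (S' l).PosSemidef)
    (hS0 : ∃ l, S' l ≠ 0) (hF : ∀ q, 1 ≤ q → q ≤ N.Q → N.composite F q ≠ 0) :
    ∃ (S : N.Cov) (E : N.Precoders), (∀ l, (S l).PosSemidef) ∧
      (∀ l, N.dualRate S' (N.adjointPrecoders F) l ≤ N.rate S E l) ∧
      ∀ i, i ≤ N.Q → N.txCost S E i = N.dualCost S' F i := by
  -- Seen from the dual network the hops run backwards: `Fin.rev` renumbers them, `fwdHop` and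
  -- `revHop` change roles, and the indices of `b` are swapped.
  have key := IFN.exists_dual_covariance (φ := N.φᵀ) (G := fun l k => (N.channel F k l)ᴴ)
    (Vf := fun i : Fin (N.Q + 1) => N.revHop F i.rev)
    (Vr := fun i : Fin (N.Q + 1) => N.fwdHop F i.rev)
    (b := fun i j => N.b F (j.rev + 1) i.rev)
    (P := fun i => N.dualCost S' F i.rev) (fun l k => N.φ_nonneg k l) N.φ_diag N.tx_pos hS' hS0
    (fun i l => N.revHop_posSemidef F (by omega) l)
    (fun l => by rw [Fin.rev_last, Fin.val_zero, revHop_zero]; exact N.Whatsrc_posDef l)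
    (fun i l => N.fwdHop_posSemidef F (by omega) l)
    (fun l => by rw [Fin.rev_zero, Fin.val_last, fwdHop_last]; exact N.Wdest_posDef l)
    (fun i j h => N.b_nonneg F (Fin.rev_lt_rev.2 h) (by omega))
    (fun i => by
      rw [Fin.rev_succ, Fin.rev_castSucc, Fin.val_succ, Fin.val_castSucc]
      exact N.b_self_pos F i.rev.2 (hF (i.rev + 1) (by omega) (by omega)))
    (fun i => by
      rw [dualCost, ← Equiv.sum_comp (Fin.revPerm (n := N.Q + 1))]
      simp only [Fin.revPerm_apply, Fin.val_fin_lt, Fin.rev_lt_rev])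
  obtain ⟨d, S, hpos, hl, hpsd, hrate, hcost⟩ := key
  have hsum : ∀ l, (∑ j : Fin (N.Q + 1), d j • N.fwdHop F j.rev l)
      = ∑ j : Fin (N.Q + 1), d j.rev • N.fwdHop F j l := fun l => by
    rw [← Equiv.sum_comp Fin.revPerm]
    simp only [Fin.revPerm_apply, Fin.rev_rev]
  have hsum' : ∀ l, (∑ j : Fin (N.Q + 1), N.revHop F j.rev l)
      = ∑ j : Fin (N.Q + 1), N.revHop F j l := fun l =>
    Equiv.sum_comp Fin.revPerm (fun j : Fin (N.Q + 1) => N.revHop F j l)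
  -- Scaling by `e` weights the forward noise of hop `i` by `(e i)⁻¹`, and the weight required is `d
  -- i.rev`.
  set e : ℕ → ℝ := hopScale (fun i : Fin (N.Q + 1) => (d i.rev)⁻¹) with he
  have hepos : ∀ i, i ≤ N.Q → 0 < e i := fun i _ => hopScale_pos (fun i => inv_pos.2 (hpos _)) i
  have heval : ∀ i : Fin (N.Q + 1), e i = (d i.rev)⁻¹ := fun i => hopScale_val _ i
  have he0 : e 0 = 1 := by
    have := heval 0
    rwa [Fin.val_zero, Fin.rev_zero, hl, inv_one] at this
  refine ⟨S, N.scalePrecoders e F, hpsd, ?_, ?_⟩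
  · intro l
    rw [N.rate_scalePrecoders hepos F he0 hpsd, dualRate_eq]
    have := hrate l
    simp only [hsum, hsum', transpose_transpose, conjTranspose_conjTranspose] at this
    simp only [heval, inv_inv]
    exact this
  · intro i hi
    obtain ⟨i, rfl⟩ : ∃ j : Fin (N.Q + 1), i = j := ⟨⟨i, by omega⟩, rfl⟩
    rw [N.txCost_scalePrecoders hepos F S hi, he0, inv_one, one_mul, heval,
      inv_mul_eq_iff_eq_mul₀ (hpos _).ne']
    have h := hcost i.rev
    rw [← Equiv.sum_comp (Fin.revPerm (n := N.Q + 1))] at h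
    simp only [Fin.revPerm_apply, Fin.rev_rev, Fin.rev_lt_rev] at h
    rw [← h]
    simp only [heval, inv_inv, Fin.val_fin_lt]

/-! ### Degenerate strategies and equality of the regions -/

theorem composite_zero (q : ℕ) : N.composite (fun _ _ => 0) q = 0 := by
  exact blockDiagonal'_zero

theorem b_zero {q q' : ℕ} (h : q ≤ q') : N.b (fun _ _ => 0) q q' = 0 := by
  rw [b, N.B_eq_zero_of_composite _ (N.composite_zero q') h le_rfl, zero_sandwich]
  simp

theorem txCost_zero {i : ℕ} (hi : i ≤ N.Q) : N.txCost (fun _ => 0) (fun _ _ => 0) i = 0 := by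
  rw [N.txCost_eq _ _ hi, Finset.sum_eq_zero (s := Finset.univ) (f := fun k : Fin (N.Q + 1) => _)]
  · simp
  · intro k _
    split_ifs with h
    · exact N.b_zero h
    · rfl

theorem dualCost_zero (i : ℕ) : N.dualCost (fun _ => 0) (fun _ _ => 0) i = 0 := by
  rw [dualCost, Finset.sum_eq_zero (s := Finset.univ) (f := fun k : Fin (N.Q + 1) => _)]
  · simp
  · intro k _
    split_ifs with h
    · exact N.b_zero h
    · rfl

theorem txCost_nonneg {S : N.Cov} (hS : ∀ l, (S l).PosSemidef) (F : N.Precoders) {i : ℕ}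
    (hi : i ≤ N.Q) : 0 ≤ N.txCost S F i := by
  rw [N.txCost_eq _ _ hi, Complex.re_sum]
  refine add_nonneg (Finset.sum_nonneg fun l _ =>
    trace_mul_re_nonneg (hS l) (N.revHop_posSemidef F hi l)) (Finset.sum_nonneg fun k _ => ?_)
  split_ifs with h
  · exact N.b_nonneg F h hi
  · exact le_rfl

theorem dualCost_nonneg {S : N.DualCov} (hS : ∀ l, (S l).PosSemidef) (F : N.Precoders) {i : ℕ}
    (hi : i ≤ N.Q) : 0 ≤ N.dualCost S F i := by
  rw [dualCost, Complex.re_sum]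
  refine add_nonneg (Finset.sum_nonneg fun l _ =>
    trace_mul_re_nonneg (hS l) (N.fwdHop_posSemidef F hi l)) (Finset.sum_nonneg fun k _ => ?_)
  split_ifs with h
  · exact N.b_nonneg F h (by omega)
  · exact le_rfl

theorem channel_eq_zero {F : N.Precoders} {q : ℕ} (h1 : 1 ≤ q) (h2 : q ≤ N.Q)
    (h : N.composite F q = 0) (l k : Fin N.L) : N.channel F l k = 0 := by
  rw [channel, N.B_eq_zero_of_composite F h h1 h2, Matrix.mul_zero, Matrix.zero_mul]

theorem rate_eq_zero {S : N.Cov} {F : N.Precoders}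
    (h : ¬((∃ l, S l ≠ 0) ∧ ∀ q, 1 ≤ q → q ≤ N.Q → N.composite F q ≠ 0)) (l : Fin N.L) :
    N.rate S F l = 0 := by
  refine IFN.rate_eq_zero_of_sandwich_eq_zero l ?_
  by_cases h0 : ∃ l, S l ≠ 0
  · have h1 : ∃ q, 1 ≤ q ∧ q ≤ N.Q ∧ N.composite F q = 0 := by
      by_contra! hne
      exact h ⟨h0, hne⟩
    obtain ⟨q, hq1, hq2, hq⟩ := h1
    rw [N.channel_eq_zero hq1 hq2 hq, zero_sandwich]
  · push Not at h0
    rw [h0 l, sandwich_zero]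

theorem dualRate_eq_zero {S : N.DualCov} {F : N.Precoders}
    (h : ¬((∃ l, S l ≠ 0) ∧ ∀ q, 1 ≤ q → q ≤ N.Q → N.composite F q ≠ 0)) (l : Fin N.L) :
    N.dualRate S (N.adjointPrecoders F) l = 0 := by
  rw [dualRate_eq]
  refine IFN.rate_eq_zero_of_sandwich_eq_zero l ?_
  by_cases h0 : ∃ l, S l ≠ 0
  · have h1 : ∃ q, 1 ≤ q ∧ q ≤ N.Q ∧ N.composite F q = 0 := by
      by_contra! hne
      exact h ⟨h0, hne⟩
    obtain ⟨q, hq1, hq2, hq⟩ := h1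
    rw [N.channel_eq_zero hq1 hq2 hq, conjTranspose_zero, zero_sandwich]
  · push Not at h0
    rw [h0 l, sandwich_zero]

theorem region_subset_dualRegion (P : ℕ → ℝ) : N.region P ⊆ N.dualRegion P := by
  rintro x ⟨hx, S, F, hS, hP, hle⟩
  refine ⟨hx, ?_⟩
  by_cases h : (∃ l, S l ≠ 0) ∧ ∀ q, 1 ≤ q → q ≤ N.Q → N.composite F q ≠ 0
  · obtain ⟨D, hD⟩ := N.exists_isStreamDecomposition F hS
    obtain ⟨d, -, -, -, hpsd, hrate, hcost⟩ := N.typeII_duality h.1 h.2 hD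
    refine ⟨_, N.typeIIPrecoders F d, hpsd, ?_, fun l => (hle l).trans (hrate l)⟩
    rw [typeIIPrecoders_eq, dualPerHop_iff]
    exact fun i hi => (hcost i hi).trans_le (hP i hi)
  · have h0 : ¬((∃ l, (fun _ => 0 : N.DualCov) l ≠ 0) ∧
        ∀ q, 1 ≤ q → q ≤ N.Q → N.composite (fun _ _ => 0) q ≠ 0) := fun h => by
      obtain ⟨⟨l, hl⟩, -⟩ := h
      exact hl rfl
    -- All rates are zero, so staying silent suffices. Zero precoders are needed as well, since
    -- otherwise the relays would still spend power on noise. The bounds are nonnegative because a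
    -- feasible strategy with nonnegative costs exists.
    refine ⟨fun _ => 0, N.adjointPrecoders fun _ _ => 0, fun _ => PosSemidef.zero, ?_, fun l => ?_⟩
    · rw [dualPerHop_iff]
      intro i hi
      rw [dualCost_zero]
      exact (N.txCost_nonneg hS F hi).trans (hP i hi)
    · rw [N.dualRate_eq_zero h0, ← N.rate_eq_zero h l]
      exact hle l

theorem dualRegion_subset_region (P : ℕ → ℝ) : N.dualRegion P ⊆ N.region P := by
  rintro x ⟨hx, S, F, hS, hP, hle⟩
  refine ⟨hx, ?_⟩
  -- Taking adjoints is an involution, so every choice of dual precoders has this form.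
  obtain ⟨F, rfl⟩ : ∃ E, F = N.adjointPrecoders E :=
    ⟨_, (N.adjointPrecoders_adjointPrecoders F).symm⟩
  rw [dualPerHop_iff] at hP
  by_cases h : (∃ l, S l ≠ 0) ∧ ∀ q, 1 ≤ q → q ≤ N.Q → N.composite F q ≠ 0
  · obtain ⟨S', E, hpsd, hrate, hcost⟩ := N.exists_cov_of_dual hS h.1 h.2
    exact ⟨S', E, hpsd, fun i hi => (hcost i hi).trans_le (hP i hi),
      fun l => (hle l).trans (hrate l)⟩
  · have h0 : ¬((∃ l, (fun _ => 0 : N.Cov) l ≠ 0) ∧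
        ∀ q, 1 ≤ q → q ≤ N.Q → N.composite (fun _ _ => 0) q ≠ 0) := fun h => by
      obtain ⟨⟨l, hl⟩, -⟩ := h
      exact hl rfl
    refine ⟨fun _ => 0, fun _ _ => 0, fun _ => PosSemidef.zero, fun i hi => ?_, fun l => ?_⟩
    · rw [N.txCost_zero hi]
      exact (N.dualCost_nonneg hS F hi).trans (hP i hi)
    · rw [N.rate_eq_zero h0, ← N.dualRate_eq_zero h l]
      exact hle l

end RelayNetwork

theorem mainTheorem2 (N : RelayNetwork) (P : ℕ → ℝ) :
    (∀ (S : N.Cov) (F : N.Precoders),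
      (∀ l, (S l).PosSemidef) → (∃ l, S l ≠ 0) →
      (∀ q, 1 ≤ q → q ≤ N.Q → N.composite F q ≠ 0) →
      N.PerHop P S F →
      (∃ D, N.IsStreamDecomposition S F D) ∧
      ∀ D, N.IsStreamDecomposition S F D →
        (∃! d, RelayNetwork.IsDominantEigenvector (N.scalingMatrix S F D) d) ∧
        ∀ d, RelayNetwork.IsDominantEigenvector (N.scalingMatrix S F D) d →
          (∀ i, 0 < d i) ∧
          (∀ l, (N.typeIICov F D d l).PosSemidef) ∧
          (∀ l, N.rate S F l ≤ N.dualRate (N.typeIICov F D d) (N.typeIIPrecoders F d) l) ∧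
          N.dualSourceCost (N.typeIICov F D d) = N.txCost S F N.Q ∧
          (∀ q, 1 ≤ q → q ≤ N.Q →
            N.dualRelayCost (N.typeIICov F D d) (N.typeIIPrecoders F d) q
              = N.txCost S F (q - 1)) ∧
          N.DualPerHop P (N.typeIICov F D d) (N.typeIIPrecoders F d)) ∧
    N.region P = N.dualRegion P := by
  refine ⟨fun S F hS hS0 hF hP => ⟨N.exists_isStreamDecomposition F hS, fun D hD => ?_⟩,
    (N.region_subset_dualRegion P).antisymm (N.dualRegion_subset_region P)⟩
  obtain ⟨d, hd, huniq, hpos, hpsd, hrate, hcost⟩ := N.typeII_duality hS0 hF hD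
  refine ⟨⟨d, hd, huniq⟩, fun d' hd' => ?_⟩
  obtain rfl := huniq d' hd'
  refine ⟨hpos, hpsd, hrate, ?_, fun q h1 h2 => ?_, ?_⟩
  · rw [N.dualSourceCost_eq _ (N.scalePrecoders (RelayNetwork.hopScale d') F)]
    exact hcost _ le_rfl
  · obtain ⟨i, rfl⟩ : ∃ i, q = i + 1 := ⟨q - 1, by omega⟩
    rw [N.typeIIPrecoders_eq, N.dualRelayCost_eq _ _ (by omega), Nat.add_sub_cancel]
    exact hcost i (by omega)
  · rw [N.typeIIPrecoders_eq, N.dualPerHop_iff]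
    exact fun i hi => (hcost i hi).trans_le (hP i hi)
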